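/- Let $m,r\ge 1$ be integers and let $S(m,r)=C_m\wr S_r=C_m^r\rtimes S_r$ be the generalized symmetric group. Let $V$ be a faithful simple (finite-dimensional) complex representation of $S(m,r)$. For $n\ge 0$ let $l(n)$ be the number of composition factors, and $b(n)$ the number of indecomposable summands, of the $\mathbb{C}S(m,r)$-module $V^{\otimes n}$, both counted with multiplicity ($b(n)$ does not depend on the chosen decomposition of $V^{\otimes n}$ into indecomposables). Put $$a(n)=\frac{1}{|S(m,r)|}\sum_{t}S_t\,\omega_V(g_t)^n\,(\dim V)^n,$$ where $g_t$ runs over those representatives of the conjugacy classes of $S(m,r)$ that act on $V$ by a scalar, $\omega_V(g_t)$ is that scalar, and $S_t$ is the sum of the entries of the column of $g_t^{-1}$ in the table of irreducible complex characters of $S(m,r)$. Then $l(n)=b(n)$ for all $n\ge 0$, $b(n)\sim a(n)$ (that is, $b(n)/a(n)\to 1$ as $n\to\infty$), and for all $n\ge 0$ $$a(n)=\begin{cases}\displaystyle\left(\sum_{k=0}^{\lfloor r/2\rfloor}\frac{1}{m^k\,(r-2k)!\,k!\,2^k}+\frac{1}{(r/2)!\,m^r}\left(\frac m2\right)^{r/2}(-1)^n\right)(\dim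 V)^n & \text{if } r \text{ and } m \text{ are both even},\\[2ex] \displaystyle\left(\sum_{k=0}^{\lfloor r/2\rfloor}\frac{1}{(r-2k)!\,k!\,2^k\,m^k}\right)(\dim V)^n & \text{otherwise.}\end{cases}$$ -/

import Mathlib

open scoped TensorProduct SemidirectProduct

noncomputable section

namespace TensorGrowth

/-- The generalized symmetric group `S(m,r) = C_m ≀ S_r = C_m^r ⋊ S_r`, where `C_m` is the cyclic
group `ℤ/m` written multiplicatively and `σ ∈ S_r` permutes coordinates,
`(σ • f) i = f (σ⁻¹ i)`. -/
abbrev GeneralizedSymmetricGroup (m r : ℕ) : Type :=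
  (Fin r → Multiplicative (ZMod m)) ⋊[mulAutArrow (G := Equiv.Perm (Fin r)) (A := Fin r)
    (M := Multiplicative (ZMod m))] Equiv.Perm (Fin r)

/-! ### Counting indecomposable summands of a module -/

/-- A module is indecomposable if it is nonzero and is not the direct sum of two nonzero
submodules. -/
def IsIndecomposable (R M : Type*) [Ring R] [AddCommGroup M] [Module R M] : Prop :=
  Nontrivial M ∧ ∀ P Q : Submodule R M, IsCompl P Q → P = ⊥ ∨ Q = ⊥

/-- `M` is the internal direct sum of `k` indecomposable submodules. -/
def HasIndecomposableDecomposition (R M : Type*) [Ring R] [AddCommGroup M] [Module R M]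
    (k : ℕ) : Prop :=
  ∃ N : Fin k → Submodule R M, DirectSum.IsInternal N ∧ ∀ i, IsIndecomposable R (N i)

/-- The number (with multiplicity) of indecomposable summands of `M`: the number of summands of a
direct sum decomposition of `M` into indecomposables. -/
def numIndecomposableSummands (R M : Type*) [Ring R] [AddCommGroup M] [Module R M] : ℕ :=
  sInf {k | HasIndecomposableDecomposition R M k}

/-! ### Tensor powers and the growth problem -/

section Growth

variable {G : Type*} [Group G] {V : Type*} [AddCommGroup V] [Module ℂ V]

/-- The representation of `G` on `V^{⊗n}` with
`g • (v₁ ⊗ ⋯ ⊗ vₙ) = (g • v₁) ⊗ ⋯ ⊗ (g • vₙ)`; for `n = 0` it is the trivial representation. -/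
def tensorPower (ρ : Representation ℂ G V) (n : ℕ) :
    Representation ℂ G (⨂[ℂ] _ : Fin n, V) where
  toFun g := PiTensorProduct.map fun _ => ρ g
  map_one' := by
    simp only [map_one]
    exact PiTensorProduct.map_one
  map_mul' g h := by
    simp only [map_mul]
    exact PiTensorProduct.map_mul _ _

/-- `V^{⊗n}` as a module over the group algebra. -/
abbrev TensorPowerModule (ρ : Representation ℂ G V) (n : ℕ) : Type _ :=
  (tensorPower ρ n).asModule

/-- `l(n)`: the number of composition factors (with multiplicity) of the `ℂG`-module
`V^{⊗n}`. -/
def numCompositionFactors (ρ : Representation ℂ G V) (n : ℕ) : ℕ∞ :=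
  Module.length (MonoidAlgebra ℂ G) (TensorPowerModule ρ n)

/-- `b(n)`: the number of indecomposable summands (with multiplicity) of the `ℂG`-module
`V^{⊗n}`. -/
def numSummands (ρ : Representation ℂ G V) (n : ℕ) : ℕ :=
  numIndecomposableSummands (MonoidAlgebra ℂ G) (TensorPowerModule ρ n)

/-- `g ∈ Z_V(G)`: the element `g` acts on `V` as a scalar. -/
def ActsAsScalar (ρ : Representation ℂ G V) (g : G) : Prop :=
  ∃ c : ℂ, ρ g = c • LinearMap.id

open Classical in
/-- `ω_V(g)`: the scalar by which `g ∈ Z_V(G)` acts on `V` (and `0` if `g ∉ Z_V(G)`). -/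
def scalarOf (ρ : Representation ℂ G V) (g : G) : ℂ :=
  if h : ActsAsScalar ρ g then h.choose else 0

variable (G) in
/-- The set of irreducible complex characters of `G`, i.e. of rows of the character table. -/
def irreducibleCharacters : Set (G → ℂ) :=
  {χ | ∃ (d : ℕ) (σ : Representation ℂ G (Fin d → ℂ)), σ.IsIrreducible ∧ σ.character = χ}

/-- The sum of the entries of the column of `g` in the character table of the finite group `G`. -/
def columnSum (g : G) : ℂ := ∑ᶠ χ ∈ irreducibleCharacters G, χ g

/-- A chosen representative of a conjugacy class. -/
def classRep (c : ConjClasses G) : G := Quotient.out (s := IsConj.setoid G) c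

/-- `a(n) = (1/|G|) ∑_t S_t ω_V(g_t)^n (dim V)^n`, over the representatives `g_t` of the conjugacy
classes of the finite group `G` which act on `V` as scalars, where `S_t` is the sum of the column
of `g_t⁻¹` in the character table of `G`. -/
def asymptoticFormula (ρ : Representation ℂ G V) (n : ℕ) : ℂ :=
  1 / (Nat.card G : ℂ) *
    ∑ᶠ c ∈ {c : ConjClasses G | ActsAsScalar ρ (classRep c)},
      columnSum (classRep c)⁻¹ * scalarOf ρ (classRep c) ^ n * (Module.finrank ℂ V : ℂ) ^ n

end Growth

end TensorGrowth

end

/-! `ℂ[G]` is semisimple for a finite group `G`, so indecomposable and simple summands coincide, and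
pairing the character of `V^{⊗n}` with the sum of all irreducible characters gives `b(n) = |G|⁻¹ ∑_g
columnSum(g⁻¹) χ_V(g)^n`. If `g` is not a scalar on `V`, then `|χ_V(g)| < dim V`, so these terms are
negligible against `(dim V)^n`; the scalar terms form `a(n)`. Since `a(n)` may oscillate, the
quotient tends to `1` only after `|a(n)|` is bounded below by `(dim V)^n / r!`.

The closed form needs the column sums at central elements. View `C_m ≀ S_r` as a group of monomial
matrices, with transpose as an anti-involution `σ`. A twisted Frobenius–Schur argument
(`HasAnisotropicForms.columnSum_eq`) gives `columnSum x = #{g | x σ(g) = g}` once every irreducible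
representation carries a nondegenerate symmetric form for which `ρ(σ g)` is adjoint to `ρ(g)`. Every
`g` is conjugate to its transpose (`exists_conj_transpose`), so such a form exists and is unique up
to scalar, hence symmetric or alternating. The alternating case is excluded by an anisotropic
vector, found by descending along the subgroups `fixingFrom j` to the diagonal matrices
(`HasAnisotropicForms.of_conj`): the form stays nonzero on an irreducible constituent of the smaller
group, because elements of the larger one are conjugate to their transposes by elements of the
smaller.

For central `x`, solvability of `x gᵀ = g` forces `x` to be a scalar matrix `a` with `a² = 1`. The
count for `a = 1` runs over all involutions of `S_r`; for the element `a` of order two (`m` even) it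
runs only over fixed-point-free ones, which is why `r` must be even there. -/

namespace Representation

/-! ### Irreducible representations: density and complements -/

theorem IsIrreducible.nontrivial {G W : Type*} [Group G] [AddCommGroup W] [Module ℂ W]
    {ρ : Representation ℂ G W} (hρ : ρ.IsIrreducible) : Nontrivial W := by
  by_contra hW
  rw [not_nontrivial_iff_subsingleton] at hW
  obtain ⟨x, y, hxy⟩ := hρ.toNontrivial
  refine hxy (SetLike.ext fun z => ?_)
  rw [Subsingleton.elim z 0]
  exact ⟨fun _ => y.toSubmodule.zero_mem, fun _ => x.toSubmodule.zero_mem⟩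

/-- Burnside's theorem: the operators of an irreducible representation span all endomorphisms. -/
theorem IsIrreducible.asAlgebraHom_surjective {G W : Type*} [Group G] [AddCommGroup W] [Module ℂ W]
    [FiniteDimensional ℂ W] (ρ : Representation ℂ G W) (hρ : ρ.IsIrreducible) :
    Function.Surjective ρ.asAlgebraHom := by
  intro f
  have hsimp : IsSimpleModule (MonoidAlgebra ℂ G) ρ.asModule :=
    (irreducible_iff_isSimpleModule_asModule ρ).mp hρ
  have hbij : Function.Bijective
      (algebraMap ℂ (Module.End (MonoidAlgebra ℂ G) ρ.asModule)) :=
    IsSimpleModule.algebraMap_end_bijective_of_isAlgClosed ℂ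
  -- By Schur the commutant of `ℂ[G]` is `ℂ`, so any `ℂ`-linear `f` commutes with it and Jacobson
  -- density applies; agreement with `r` on a basis is enough.
  let F : Module.End (Module.End (MonoidAlgebra ℂ G) ρ.asModule) ρ.asModule :=
    { toFun := fun v => f v
      map_add' := fun v w => f.map_add v w
      map_smul' := fun e v => by
        obtain ⟨c, rfl⟩ := hbij.2 e
        exact f.map_smul c v }
  let b := Module.finBasis ℂ W
  have : DecidableEq ρ.asModule := Classical.decEq _
  obtain ⟨r, hr⟩ := jacobson_density F (Finset.univ.image fun i => (b i : ρ.asModule))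
  refine ⟨r, b.ext fun i => ?_⟩
  exact (hr (b i) (Finset.mem_image_of_mem _ (Finset.mem_univ i))).symm

theorem _root_.Subrepresentation.toRepresentation_isIrreducible {G W : Type*} [Group G]
    [AddCommGroup W] [Module ℂ W] {ρ : Representation ℂ G W} (U : Subrepresentation ρ)
    (hU : IsAtom U) : U.toRepresentation.IsIrreducible := by
  have : Nontrivial (Subrepresentation U.toRepresentation) := by
    refine ⟨⊥, ⊤, fun h => hU.1 (bot_unique fun x hx => ?_)⟩
    have : (⟨x, hx⟩ : U.toSubmodule) ∈ (⊥ : Subrepresentation U.toRepresentation) := by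
      rw [h]; trivial
    exact congrArg Subtype.val ((Submodule.mem_bot ℂ).mp this)
  refine ⟨fun S => ?_⟩
  let T : Subrepresentation ρ :=
    { toSubmodule := S.toSubmodule.map U.toSubmodule.subtype
      apply_mem_toSubmodule := by
        rintro g _ ⟨x, hx, rfl⟩
        exact ⟨U.toRepresentation g x, S.apply_mem_toSubmodule g hx, rfl⟩ }
  have hTU : T ≤ U := by
    rintro _ ⟨x, -, rfl⟩
    exact x.2
  rcases hU.le_iff.mp hTU with h | h
  · left
    refine bot_unique fun x hx => ?_
    have : (x : W) ∈ T := ⟨x, hx, rfl⟩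
    rw [h] at this
    exact (Submodule.mem_bot ℂ).mpr (Subtype.ext ((Submodule.mem_bot ℂ).mp this))
  · right
    refine top_unique fun x _ => ?_
    have : (x : W) ∈ T := by rw [h]; exact x.2
    obtain ⟨y, hy, hyx⟩ := this
    rwa [← Subtype.ext (show (y : W) = x from hyx)]

/-- A nonzero representation of a finite group contains an irreducible subrepresentation with an
invariant complement. -/
theorem exists_irreducible_isCompl {G W : Type*} [Group G] [Finite G] [AddCommGroup W] [Module ℂ W]
    [Nontrivial W] (ρ : Representation ℂ G W) :
    ∃ U U' : Subrepresentation ρ, U.toRepresentation.IsIrreducible ∧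
      IsCompl U.toSubmodule U'.toSubmodule := by
  have : Nontrivial ρ.asModule := ‹Nontrivial W›
  obtain ⟨m, hm⟩ := IsSemisimpleModule.exists_simple_submodule (MonoidAlgebra ℂ G) ρ.asModule
  have hU : IsAtom (Subrepresentation.subrepresentationSubmoduleOrderIso (ρ := ρ).symm m) :=
    (OrderIso.isAtom_iff _ _).mpr (isSimpleModule_iff_isAtom.mp hm)
  set U := Subrepresentation.subrepresentationSubmoduleOrderIso (ρ := ρ).symm m
  obtain ⟨U', hU'⟩ := exists_isCompl U
  refine ⟨U, U', ?_, ?_⟩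
  · exact U.toRepresentation_isIrreducible hU
  · refine ⟨disjoint_iff.mpr ?_, codisjoint_iff.mpr ?_⟩
    · exact congrArg Subrepresentation.toSubmodule hU'.inf_eq_bot
    · exact congrArg Subrepresentation.toSubmodule hU'.sup_eq_top

end Representation

/-! ### Invariant bilinear forms and their symmetry -/

namespace TensorGrowth

/-- For a map `σ` of a group `K`, every nonzero `σ`-invariant bilinear form on an irreducible
representation of `K` has an anisotropic vector. -/
def HasAnisotropicForms (K : Type*) [Group K] (σ : K → K) : Prop :=
  ∀ (W : Type) [AddCommGroup W] [Module ℂ W] [FiniteDimensional ℂ W] (ρ : Representation ℂ K W),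
    ρ.IsIrreducible → ∀ B : W →ₗ[ℂ] W →ₗ[ℂ] ℂ, B ≠ 0 →
      (∀ k v w, B (ρ k v) w = B v (ρ (σ k) w)) → ∃ v, B v v ≠ 0

theorem HasAnisotropicForms.of_subsingleton {K : Type*} [Group K] [Subsingleton K] (σ : K → K) :
    HasAnisotropicForms K σ := by
  intro W _ _ _ ρ hρ B hB _
  have : IsMulCommutative K := ⟨⟨fun a b => Subsingleton.elim _ _⟩⟩
  have h1 : Module.finrank ℂ W = 1 := Representation.IsIrreducible.finrank_eq_one_of_isMulCommutative ρ
  by_contra! hcon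
  apply hB
  obtain ⟨v, hv, hspan⟩ := finrank_eq_one_iff'.mp h1
  ext x y
  obtain ⟨a, rfl⟩ := hspan x
  obtain ⟨b, rfl⟩ := hspan y
  simp [hcon]

theorem ker_eq_bot_of_invariant {K W : Type*} [Group K] [AddCommGroup W] [Module ℂ W]
    (ρ : Representation ℂ K W) (hρ : ρ.IsIrreducible) (B : W →ₗ[ℂ] W →ₗ[ℂ] ℂ) (hB : B ≠ 0)
    (σ : K → K) (hinv : ∀ k v w, B (ρ k v) w = B v (ρ (σ k) w)) : LinearMap.ker B = ⊥ := by
  let rad : Subrepresentation ρ :=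
    { toSubmodule := LinearMap.ker B
      apply_mem_toSubmodule := fun g v hv => by
        rw [LinearMap.mem_ker] at hv ⊢
        ext w
        rw [hinv, hv]; rfl }
  rcases eq_bot_or_eq_top rad with h0 | h0
  · exact congrArg Subrepresentation.toSubmodule h0
  · refine absurd (LinearMap.ext fun v => ?_) hB
    have : v ∈ rad := by rw [h0]; trivial
    exact this

/-- Descent from `K` to `L`: the projection onto an irreducible `L`-constituent `U` commutes with
`L`, hence is an `L`-average of elements of `ℂ[K]`. Because `σK` moves each `k` only within its
`L`-conjugacy class, such averages are self-adjoint. So `U` is orthogonal to its complement, the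
form does not vanish on `U`, and an anisotropic vector of `U` serves for `W`. -/
theorem HasAnisotropicForms.of_conj {L K : Type*} [Group L] [Finite L] [Group K] [Finite K]
    (ι : L →* K) (σL : L → L) (σK : K → K) (hι : ∀ l, ι (σL l) = σK (ι l))
    (hL : Function.Involutive σL)
    (hmul : ∀ a b, σK (a * b) = σK b * σK a)
    (hconj : ∀ k, ∃ l, σK k = ι l * k * (ι l)⁻¹)
    (h : HasAnisotropicForms L σL) : HasAnisotropicForms K σK := by
  classical
  intro W _ _ _ ρ hρ B hB hinv
  have hone : σK 1 = 1 := by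
    have := hmul 1 1
    simpa using this
  have hsinv : ∀ k, σK k⁻¹ = (σK k)⁻¹ := fun k => by
    rw [eq_inv_iff_mul_eq_one, ← hmul, mul_inv_cancel, hone]
  have hnt : Nontrivial W := hρ.nontrivial
  have hnd : ∀ v, v ≠ 0 → ∃ w, B v w ≠ 0 := by
    intro v hv
    by_contra! hcon
    refine hv ((Submodule.mem_bot ℂ).mp ?_)
    rw [← ker_eq_bot_of_invariant ρ hρ B hB σK hinv]
    exact LinearMap.ext hcon
  obtain ⟨U, U', hU, hc⟩ := Representation.exists_irreducible_isCompl (ρ.comp ι)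
  let P : W →ₗ[ℂ] W := U.toSubmodule.projection U'.toSubmodule hc
  have hPU : ∀ v, P v ∈ U.toSubmodule := fun v => Submodule.projection_apply_mem _ _
  have hPid : ∀ v ∈ U.toSubmodule, P v = v := fun v hv =>
    Submodule.projection_apply_left hc ⟨v, hv⟩
  have hP0 : ∀ v ∈ U'.toSubmodule, P v = 0 := fun v hv =>
    (Submodule.projection_apply_eq_zero_iff hc).mpr hv
  have hPcomm : ∀ l v, P (ρ (ι l) v) = ρ (ι l) (P v) := by
    intro l v
    obtain ⟨a, ha, b, hb, rfl⟩ : ∃ a ∈ U.toSubmodule, ∃ b ∈ U'.toSubmodule, a + b = v := by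
      rw [← Submodule.mem_sup, hc.sup_eq_top]; trivial
    have ha' : ρ (ι l) a ∈ U.toSubmodule := U.apply_mem_toSubmodule l ha
    have hb' : ρ (ι l) b ∈ U'.toSubmodule := U'.apply_mem_toSubmodule l hb
    simp only [map_add, hPid _ ha, hPid _ ha', hP0 _ hb, hP0 _ hb', map_zero]
  -- Burnside's theorem writes the projection as a combination of the operators `ρ k`, to be
  -- averaged over `L`.
  obtain ⟨r, hr⟩ := Representation.IsIrreducible.asAlgebraHom_surjective ρ hρ P
  have hsum : ∀ v, P v = r.coeff.sum fun k c => c • ρ k v := fun v => by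
    rw [← hr, Representation.asAlgebraHom_def, MonoidAlgebra.lift_apply, Finsupp.sum,
      LinearMap.sum_apply]
    rfl
  have hLfin : Fintype L := Fintype.ofFinite L
  have havg : ∀ k v w, ∑ l : L, B (ρ (ι l * k * (ι l)⁻¹) v) w =
      ∑ l : L, B v (ρ (ι l * k * (ι l)⁻¹) w) := by
    intro k v w
    obtain ⟨l₀, hl₀⟩ := hconj k
    -- The adjoint of the operator of `ι l * k * (ι l)⁻¹` is that of the conjugate of `k` by `ι ((σL
    -- l)⁻¹ * l₀)`; this bijection of `L` only permutes the sum.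
    let e : L ≃ L := (hL.toPerm).trans ((Equiv.inv L).trans (Equiv.mulRight l₀))
    refine Fintype.sum_equiv e _ _ fun l => ?_
    rw [hinv, hmul, hmul, hsinv, hl₀]
    have : (σK (ι l))⁻¹ * (ι l₀ * k * (ι l₀)⁻¹ * σK (ι l)) = ι (e l) * k * (ι (e l))⁻¹ := by
      simp only [e, Equiv.trans_apply, Function.Involutive.coe_toPerm, Equiv.inv_apply,
        Equiv.coe_mulRight, map_mul, map_inv, hι]
      group
    rw [this]
  have hPavg : ∀ v, (Fintype.card L : ℂ) • P v =
      r.coeff.sum fun k c => c • ∑ l : L, ρ (ι l * k * (ι l)⁻¹) v := by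
    intro v
    have : (Fintype.card L : ℂ) • P v = ∑ l : L, ρ (ι l) (P (ρ (ι l)⁻¹ v)) := by
      rw [Finset.sum_congr rfl fun l _ => (hPcomm l _).symm]
      simp [← LinearMap.comp_apply, ← Module.End.mul_eq_comp, ← map_mul, Nat.cast_smul_eq_nsmul]
    rw [this]
    simp only [hsum, Finsupp.sum, map_sum, map_smul, Finset.smul_sum]
    rw [Finset.sum_comm]
    simp [map_mul]
  have hself : ∀ v w, B (P v) w = B v (P w) := by
    intro v w
    have hcard : (Fintype.card L : ℂ) ≠ 0 := by simp
    refine mul_left_cancel₀ hcard ?_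
    rw [← smul_eq_mul, ← smul_eq_mul, ← LinearMap.smul_apply, ← map_smul, hPavg, ← map_smul, hPavg]
    simp only [Finsupp.sum, map_sum, map_smul, LinearMap.sum_apply, LinearMap.smul_apply]
    exact Finset.sum_congr rfl fun k _ => by rw [havg]
  let BU : U.toSubmodule →ₗ[ℂ] U.toSubmodule →ₗ[ℂ] ℂ :=
    B.compl₁₂ U.toSubmodule.subtype U.toSubmodule.subtype
  have hBU : BU ≠ 0 := by
    have : Nontrivial U.toSubmodule := hU.nontrivial
    obtain ⟨u, hu⟩ := exists_ne (0 : U.toSubmodule)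
    obtain ⟨w, hw⟩ := hnd u (fun h0 => hu (Subtype.ext h0))
    intro hz
    apply hw
    rw [← hPid u u.2, hself]
    exact LinearMap.congr_fun (LinearMap.congr_fun hz u) ⟨P w, hPU w⟩
  obtain ⟨v, hv⟩ := h U.toSubmodule U.toRepresentation hU BU hBU fun k v w => by
    have := hinv (ι k) v w
    rw [← hι] at this
    exact this
  exact ⟨v, hv⟩

/-- If all elements of `G` are conjugate to their images under an anti-involution `σ`, then an
irreducible representation of `G` carries a nonzero symmetric `σ`-invariant bilinear form, provided
`σ`-invariant forms have anisotropic vectors. -/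
theorem HasAnisotropicForms.exists_symmetric_form {G : Type*} [Group G] [Finite G] {σ : G → G}
    (h : HasAnisotropicForms G σ) (hσ : Function.Involutive σ)
    (hmul : ∀ a b, σ (a * b) = σ b * σ a) (hconj : ∀ g, ∃ l, σ g = l * g * l⁻¹)
    {W : Type} [AddCommGroup W] [Module ℂ W] [FiniteDimensional ℂ W] (ρ : Representation ℂ G W)
    (hρ : ρ.IsIrreducible) :
    ∃ B : W →ₗ[ℂ] W →ₗ[ℂ] ℂ, B ≠ 0 ∧ (∀ k v w, B (ρ k v) w = B v (ρ (σ k) w)) ∧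
      ∀ v w, B v w = B w v := by
  have hone : σ 1 = 1 := by
    have := hmul 1 1
    simpa using this
  have hsinv : ∀ k, σ k⁻¹ = (σ k)⁻¹ := fun k => by
    rw [eq_inv_iff_mul_eq_one, ← hmul, mul_inv_cancel, hone]
  -- Composing `σ` with inversion turns the anti-automorphism into a homomorphism; `σ`-invariant
  -- forms are then intertwiners from `ρ` to the dual of its `τ`-twist.
  let τ : G →* G :=
    { toFun := fun g => (σ g)⁻¹
      map_one' := by simp [hone]
      map_mul' := fun a b => by simp [hmul] }
  let ρ' : Representation ℂ G (Module.Dual ℂ W) := Representation.dual (ρ.comp τ)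
  have hρ' : ∀ g (f : Module.Dual ℂ W) w, ρ' g f w = f (ρ (σ g) w) := by
    intro g f w
    simp only [ρ', Representation.dual_apply, Module.Dual.transpose_apply, LinearMap.comp_apply,
      MonoidHom.comp_apply]
    simp [τ, hsinv]
  have hFin : Fintype G := Fintype.ofFinite G
  have hInv : Invertible (Nat.card G : ℂ) := invertibleOfNonzero (by simp)
  -- The twisted dual has the same character as `ρ`, because `σ g` is conjugate to `g`; hence
  -- invariant forms make up a line.
  have hdim : Module.finrank ℂ (Representation.IntertwiningMap ρ ρ') = 1 := by
    have h1 := Representation.card_inv_mul_sum_char_mul_char_eq_finrank ρ ρ'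
    have h2 := Representation.card_inv_mul_sum_char_mul_char_eq_finrank ρ ρ
    have h3 : ρ'.character = ρ.character := by
      ext g
      simp only [ρ', Representation.char_dual]
      obtain ⟨l, hl⟩ := hconj g
      calc Representation.character (ρ.comp τ) g⁻¹ = ρ.character (τ g⁻¹) := rfl
        _ = ρ.character g := by
          simp [τ, hsinv, hl]
    rw [h3, h2, Representation.IsIrreducible.finrank_intertwiningMap_self] at h1
    exact_mod_cast h1.symm
  obtain ⟨β, hβ, hspan⟩ := finrank_eq_one_iff'.mp hdim
  let B : W →ₗ[ℂ] W →ₗ[ℂ] ℂ := β.toLinearMap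
  have hB : ∀ k v w, B (ρ k v) w = B v (ρ (σ k) w) := fun k v w => by
    have := LinearMap.congr_fun (Representation.IntertwiningMap.isIntertwining _ _ β k v) w
    rw [hρ'] at this
    exact this
  have hB0 : B ≠ 0 := fun h0 => hβ (Representation.IntertwiningMap.ext h0)
  obtain ⟨v₀, hv₀⟩ := h W ρ hρ B hB0 hB
  let γ : Representation.IntertwiningMap ρ ρ' :=
    LinearMap.intertwiningMap_of_isIntertwiningMap ρ ρ' B.flip fun g v => by
      ext w
      rw [hρ', LinearMap.flip_apply, LinearMap.flip_apply, hB, hσ]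
  -- The flipped form is again invariant, so it is `c` times `B`; evaluating at the anisotropic
  -- vector forces `c = 1`.
  obtain ⟨c, hc⟩ := hspan γ
  have hcB : ∀ v w, c * B v w = B w v := fun v w =>
    LinearMap.congr_fun (congrArg (fun f : Representation.IntertwiningMap ρ ρ' => f v) hc) w
  have hc1 : c = 1 := mul_right_cancel₀ hv₀ (by rw [hcB, one_mul])
  exact ⟨B, hB0, hB, fun v w => by rw [← hcB, hc1, one_mul]⟩

/-! ### Matrix blocks of the group algebra and the irreducible characters -/

section Wedderburn

variable {G : Type*} [Group G] {n : ℕ} {d : Fin n → ℕ}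

/-- The representation of `G` on the column vectors of a matrix block of `ℂ[G]`. -/
noncomputable def blockRep (e : MonoidAlgebra ℂ G ≃ₐ[ℂ] Π i, Matrix (Fin (d i)) (Fin (d i)) ℂ) (i : Fin n) :
    Representation ℂ G (Fin (d i) → ℂ) where
  toFun g := Matrix.toLin' (e (MonoidAlgebra.of ℂ G g) i)
  map_one' := by rw [map_one, map_one, Pi.one_apply, Matrix.toLin'_one]; rfl
  map_mul' g h := by simp only [map_mul, Pi.mul_apply, Matrix.toLin'_mul]; rfl

variable (e : MonoidAlgebra ℂ G ≃ₐ[ℂ] Π i, Matrix (Fin (d i)) (Fin (d i)) ℂ)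

theorem blockRep_apply (i : Fin n) (g : G) (v : Fin (d i) → ℂ) :
    blockRep e i g v = Matrix.mulVec (e (MonoidAlgebra.of ℂ G g) i) v := rfl

theorem blockRep_character (i : Fin n) (g : G) :
    (blockRep e i).character g = Matrix.trace (e (MonoidAlgebra.of ℂ G g) i) := by
  rw [Representation.character, ← Matrix.trace_toLin'_eq]
  rfl

theorem blockRep_asAlgebraHom (i : Fin n) (a : MonoidAlgebra ℂ G) (v : Fin (d i) → ℂ) :
    (blockRep e i).asAlgebraHom a v = Matrix.mulVec (e a i) v := by
  induction a using MonoidAlgebra.induction_linear with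
  | zero => simp
  | add f g hf hg => simp [hf, hg, Matrix.add_mulVec]
  | single g r =>
    rw [Representation.asAlgebraHom_single, LinearMap.smul_apply, blockRep_apply,
      ← Matrix.smul_mulVec, ← Pi.smul_apply, ← map_smul]
    simp

/-- The group algebra acts through all matrices of the block, and a rank-one matrix carries a
nonzero vector to any prescribed one. -/
theorem blockRep_isIrreducible [∀ i, NeZero (d i)] (i : Fin n) :
    (blockRep e i).IsIrreducible := by
  have hmat : ∀ (S : Subrepresentation (blockRep e i)) (A : Matrix (Fin (d i)) (Fin (d i)) ℂ) v,
      v ∈ S → Matrix.mulVec A v ∈ S := by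
    intro S A v hv
    have h1 := (Subrepresentation.asSubmodule S).smul_mem (e.symm (Pi.single i A)) hv
    have h2 := blockRep_asAlgebraHom e i (e.symm (Pi.single i A)) v
    rw [AlgEquiv.apply_symm_apply, Pi.single_eq_same] at h2
    rw [← h2]
    exact h1
  have hnt : Nontrivial (Subrepresentation (blockRep e i)) := by
    refine ⟨⊥, ⊤, fun h => ?_⟩
    have : (1 : Fin (d i) → ℂ) ∈ (⊥ : Subrepresentation (blockRep e i)) := by rw [h]; trivial
    exact one_ne_zero ((Submodule.mem_bot ℂ).mp this)
  refine ⟨fun S => ?_⟩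
  by_cases hS : ∀ v ∈ S, v = 0
  · exact Or.inl (bot_unique fun v hv => (Submodule.mem_bot ℂ).mpr (hS v hv))
  · right
    push Not at hS
    obtain ⟨v, hv, hv0⟩ := hS
    obtain ⟨j, hj⟩ := Function.ne_iff.mp hv0
    refine top_unique fun w _ => ?_
    have := hmat S (Matrix.vecMulVec w (Pi.single j (v j)⁻¹)) v hv
    rwa [Matrix.vecMulVec_mulVec, single_dotProduct, inv_mul_cancel₀ hj, MulOpposite.op_one,
      one_smul] at this

/-- The central idempotent of block `i` acts as the identity on one side and as zero on the other.
-/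
theorem blockRep_isEmpty_equiv [∀ i, NeZero (d i)] {i j : Fin n} (hij : i ≠ j) :
    IsEmpty (Representation.Equiv (blockRep e i) (blockRep e j)) := by
  refine ⟨fun f => ?_⟩
  have hf : ∀ (a : MonoidAlgebra ℂ G) v,
      f ((blockRep e i).asAlgebraHom a v) = (blockRep e j).asAlgebraHom a (f v) := by
    intro a v
    induction a using MonoidAlgebra.induction_linear with
    | zero => simp
    | add a b ha hb => simp [ha, hb]
    | single g r => simpa using congrArg (r • ·) (Representation.IntertwiningMap.isIntertwining _ _ f.toIntertwiningMap g v)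
  have h1 := hf (e.symm (Pi.single i 1)) 1
  rw [blockRep_asAlgebraHom, blockRep_asAlgebraHom, AlgEquiv.apply_symm_apply, Pi.single_eq_same,
    Pi.single_eq_of_ne hij.symm, Matrix.one_mulVec, Matrix.zero_mulVec, ← map_zero f] at h1
  exact one_ne_zero (f.toLinearEquiv.injective h1)

/-- Placing a vector in column `k` of block `i` and acting on a fixed `w` is an intertwiner from the
block into `W`. If no block were isomorphic to `W`, all of these would vanish by Schur, and then so
would the action of `1`. -/
theorem exists_equiv_blockRep [∀ i, NeZero (d i)] {W : Type*} [AddCommGroup W] [Module ℂ W]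
    (ρ : Representation ℂ G W) (hρ : ρ.IsIrreducible) :
    ∃ i, Nonempty (Representation.Equiv (blockRep e i) ρ) := by
  by_contra! hcon
  have hirr := blockRep_isIrreducible e
  have key : ∀ w i (A : Matrix (Fin (d i)) (Fin (d i)) ℂ),
      ρ.asAlgebraHom (e.symm (Pi.single i A)) w = 0 := by
    intro w i A
    have hcol : ∀ k : Fin (d i), ∀ v : Fin (d i) → ℂ,
        ρ.asAlgebraHom (e.symm (Pi.single i (Matrix.vecMulVec v (Pi.single k 1)))) w = 0 := by
      intro k v
      let T : (Fin (d i) → ℂ) →ₗ[ℂ] W :=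
        { toFun := fun v =>
            ρ.asAlgebraHom (e.symm (Pi.single i (Matrix.vecMulVec v (Pi.single k 1)))) w
          map_add' := fun u v => by
            rw [Matrix.add_vecMulVec, Pi.single_add, map_add, map_add, LinearMap.add_apply]
          map_smul' := fun c v => by
            rw [Matrix.smul_vecMulVec, Pi.single_smul, map_smul, map_smul]; rfl }
      have hT : ∀ g v, T (blockRep e i g v) = ρ g (T v) := by
        intro g v
        change ρ.asAlgebraHom _ w = ρ g (ρ.asAlgebraHom _ w)
        rw [blockRep_apply, ← Representation.asAlgebraHom_of, ← Module.End.mul_apply, ← map_mul,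
          ← e.symm_apply_apply (MonoidAlgebra.of ℂ G g), ← map_mul, e.symm_apply_apply,
          ← Matrix.mul_vecMulVec, ← Pi.single_mul_right]
      have := hcon i
      have h0 : T.intertwiningMap_of_isIntertwiningMap _ _ hT = 0 := Subsingleton.elim _ _
      exact congrArg (fun f : Representation.IntertwiningMap (blockRep e i) ρ => f v) h0
    have hA : A = ∑ k, Matrix.vecMulVec (fun j => A j k) (Pi.single k 1) := by
      ext a b
      simp [Matrix.sum_apply, Matrix.vecMulVec_apply, Pi.single_apply]
    rw [hA, ← LinearMap.single_apply (R := ℂ), map_sum, map_sum, map_sum, LinearMap.sum_apply]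
    exact Finset.sum_eq_zero fun k _ => hcol k _
  have hW : ∀ w : W, w = 0 := by
    intro w
    have h1 : ρ.asAlgebraHom (e.symm (∑ i, Pi.single i (1 : Matrix (Fin (d i)) (Fin (d i)) ℂ))) w
        = w := by
      rw [Finset.univ_sum_single (fun i => (1 : Matrix (Fin (d i)) (Fin (d i)) ℂ))]
      change ρ.asAlgebraHom (e.symm 1) w = w
      simp
    rw [← h1, map_sum, map_sum, LinearMap.sum_apply]
    exact Finset.sum_eq_zero fun i _ => key w i 1
  have := hρ.nontrivial
  obtain ⟨w, hw⟩ := exists_ne (0 : W)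
  exact hw (hW w)

theorem blockRep_character_injective [Finite G] [∀ i, NeZero (d i)] :
    Function.Injective fun i => (blockRep e i).character := by
  intro i j hij
  by_contra hne
  have := blockRep_isIrreducible e
  have hFin : Fintype G := Fintype.ofFinite G
  have hInv : Invertible (Nat.card G : ℂ) := invertibleOfNonzero (by simp)
  have h1 := Representation.char_orthonormal (blockRep e i) (blockRep e i)
  have h2 := Representation.char_orthonormal (blockRep e i) (blockRep e j)
  rw [if_pos ⟨Representation.Equiv.refl _⟩] at h1
  rw [if_neg (not_nonempty_iff.mpr (blockRep_isEmpty_equiv e (Ne.symm hne))),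
    ← (show (blockRep e i).character = (blockRep e j).character from hij), h1] at h2
  simp at h2

theorem irreducibleCharacters_eq_range [∀ i, NeZero (d i)] :
    irreducibleCharacters G = Set.range fun i => (blockRep e i).character := by
  ext χ
  constructor
  · rintro ⟨k, σ, hσ, rfl⟩
    obtain ⟨i, ⟨f⟩⟩ := exists_equiv_blockRep e σ hσ
    exact ⟨i, Representation.char_iso f⟩
  · rintro ⟨i, rfl⟩
    exact ⟨d i, blockRep e i, blockRep_isIrreducible e i, rfl⟩

theorem columnSum_eq_sum_trace [Finite G] [∀ i, NeZero (d i)] (x : G) :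
    columnSum x = ∑ i, Matrix.trace (e (MonoidAlgebra.of ℂ G x) i) := by
  rw [columnSum, irreducibleCharacters_eq_range e,
    finsum_mem_range (blockRep_character_injective e), finsum_eq_sum_of_fintype]
  exact Finset.sum_congr rfl fun i _ => blockRep_character e i x

end Wedderburn

/-! ### The twisted Frobenius–Schur formula for column sums -/

/-- For a matrix `J`, the map `X ↦ A Xᵀ J` on square matrices, as the component of an endomorphism
of a product of matrix algebras. -/
theorem trace_pi_mul_transpose_mul {n : ℕ} {d : Fin n → ℕ}
    (A J : Π i, Matrix (Fin (d i)) (Fin (d i)) ℂ)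
    (T : Module.End ℂ (Π i, Matrix (Fin (d i)) (Fin (d i)) ℂ))
    (hT : ∀ X i, T X i = A i * (X i).transpose * J i) :
    LinearMap.trace ℂ _ T = ∑ i, Matrix.trace (A i * (J i).transpose) := by
  classical
  let b := Pi.basis (fun i => Matrix.stdBasis ℂ (Fin (d i)) (Fin (d i)))
  rw [LinearMap.trace_eq_matrix_trace ℂ b, Matrix.trace]
  simp only [Matrix.diag_apply, LinearMap.toMatrix_apply, b, Pi.basis_repr, Pi.basis_apply]
  rw [Fintype.sum_sigma]
  refine Finset.sum_congr rfl fun i _ => ?_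
  rw [Fintype.sum_prod_type, Matrix.trace]
  refine Finset.sum_congr rfl fun a _ => ?_
  rw [Matrix.diag_apply, Matrix.mul_apply]
  refine Finset.sum_congr rfl fun c _ => ?_
  change T _ i a c = _
  -- The matrix unit at `(a, c)` contributes the `(a, c)` entry of `A E_{ca} J`, namely `A_{ac}
  -- J_{ac}`.
  rw [hT, Pi.single_eq_same, Matrix.stdBasis_eq_single, Matrix.transpose_single,
    Matrix.transpose_apply, Matrix.mul_apply, Finset.sum_eq_single a]
  · simp
  · intro k _ hk
    rw [Matrix.mul_single_apply_of_ne _ _ _ _ _ (by exact hk), zero_mul]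
  · simp

/-- `J` is the Gram matrix of the symmetric form; its determinant is nonzero because the radical is
a proper subrepresentation of an irreducible one. -/
theorem HasAnisotropicForms.exists_symmetric_matrix {G : Type*} [Group G] [Finite G] {σ : G → G}
    (h : HasAnisotropicForms G σ) (hσ : Function.Involutive σ)
    (hmul : ∀ a b, σ (a * b) = σ b * σ a) (hconj : ∀ g, ∃ l, σ g = l * g * l⁻¹) {k : ℕ}
    (ρ : Representation ℂ G (Fin k → ℂ)) (hρ : ρ.IsIrreducible) :
    ∃ J : Matrix (Fin k) (Fin k) ℂ, IsUnit J.det ∧ J.transpose = J ∧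
      ∀ g, J * LinearMap.toMatrix' (ρ (σ g)) = (LinearMap.toMatrix' (ρ g)).transpose * J := by
  obtain ⟨B, hB, hinv, hsymm⟩ := h.exists_symmetric_form hσ hmul hconj ρ hρ
  refine ⟨LinearMap.toMatrix₂' ℂ B, ?_, ?_, fun g => ?_⟩
  · rw [isUnit_iff_ne_zero, ← LinearMap.separatingLeft_toLinearMap₂'_iff_det_ne_zero,
      Matrix.toLinearMap₂'_toMatrix', LinearMap.separatingLeft_iff_ker_eq_bot]
    exact ker_eq_bot_of_invariant ρ hρ B hB σ hinv
  · ext a b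
    simp [LinearMap.toMatrix₂'_apply, hsymm]
  · have h1 : B.comp (ρ g) = B.compl₂ (ρ (σ g)) := LinearMap.ext₂ fun v w => hinv g v w
    have h2 := congrArg (LinearMap.toMatrix₂' ℂ) h1
    rw [LinearMap.toMatrix₂'_comp, LinearMap.toMatrix₂'_compl₂] at h2
    exact h2.symm

/-- Compute the trace of `g ↦ x σ(g)` on `ℂ[G]` twice. In the group basis it counts fixed elements.
In a matrix block the map is `X ↦ ρ(x) J⁻¹ Xᵀ J`, of trace `tr(ρ(x) J⁻¹ Jᵀ)`, which is `tr ρ(x)` as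
`J` is symmetric. -/
theorem HasAnisotropicForms.columnSum_eq {G : Type*} [Group G] [Finite G] {σ : G → G}
    (h : HasAnisotropicForms G σ) (hσ : Function.Involutive σ)
    (hmul : ∀ a b, σ (a * b) = σ b * σ a) (hconj : ∀ g, ∃ l, σ g = l * g * l⁻¹) (x : G) :
    columnSum x = (Nat.card {g : G // x * σ g = g} : ℂ) := by
  classical
  obtain ⟨n, d, hd, ⟨e⟩⟩ :=
    IsSemisimpleRing.exists_algEquiv_pi_matrix_of_isAlgClosed ℂ (MonoidAlgebra ℂ G)
  have hFin : Fintype G := Fintype.ofFinite G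
  have hJ : ∀ i, ∃ J : Matrix (Fin (d i)) (Fin (d i)) ℂ, IsUnit J.det ∧ J.transpose = J ∧
      ∀ g, J * e (MonoidAlgebra.of ℂ G (σ g)) i =
        (e (MonoidAlgebra.of ℂ G g) i).transpose * J := fun i => by
    have := h.exists_symmetric_matrix hσ hmul hconj (blockRep e i) (blockRep_isIrreducible e i)
    simpa only [blockRep, MonoidHom.coe_mk, OneHom.coe_mk, LinearMap.toMatrix'_toLin'] using this
  choose J hJdet hJsymm hJ using hJ
  let b : Module.Basis G ℂ (MonoidAlgebra ℂ G) :=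
    Finsupp.basisSingleOne.map (MonoidAlgebra.coeffLinearEquiv ℂ).symm
  have hb : ∀ g, b g = MonoidAlgebra.of ℂ G g := fun g => by simp [b]
  let T : Module.End ℂ (MonoidAlgebra ℂ G) := b.constr ℂ fun g => b (x * σ g)
  have hT1 : LinearMap.trace ℂ _ T = (Nat.card {g : G // x * σ g = g} : ℂ) := by
    rw [LinearMap.trace_eq_matrix_trace ℂ b, Matrix.trace]
    simp only [Matrix.diag_apply, LinearMap.toMatrix_apply, T, Module.Basis.constr_basis,
      Module.Basis.repr_self, Finsupp.single_apply]
    rw [Finset.sum_boole, Nat.card_eq_fintype_card, Fintype.card_subtype]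
  have hT2 := trace_pi_mul_transpose_mul
    (fun i => e (MonoidAlgebra.of ℂ G x) i * (J i)⁻¹) J (e.toLinearEquiv.conj T) (by
      intro X i
      obtain ⟨a, rfl⟩ := e.surjective X
      change e (T (e.symm (e a))) i = _
      rw [e.symm_apply_apply]
      induction a using MonoidAlgebra.induction_linear with
      | zero => simp
      | add a b ha hb => simp only [map_add, Pi.add_apply, ha, hb, Matrix.transpose_add,
          Matrix.mul_add, Matrix.add_mul]
      | single g r =>
        have hs : (MonoidAlgebra.single g r : MonoidAlgebra ℂ G) = r • b g := by
          rw [hb, MonoidAlgebra.of_apply, MonoidAlgebra.smul_single, smul_eq_mul, mul_one]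
        have h3 : (J i)⁻¹ * ((e (MonoidAlgebra.of ℂ G g) i).transpose * J i) =
            e (MonoidAlgebra.of ℂ G (σ g)) i := by
          rw [← hJ, ← Matrix.mul_assoc, Matrix.nonsing_inv_mul _ (hJdet i), Matrix.one_mul]
        rw [hs, map_smul, map_smul, map_smul, Pi.smul_apply, Pi.smul_apply, Matrix.transpose_smul,
          Matrix.mul_smul, Matrix.smul_mul, Module.Basis.constr_basis, hb, hb, Matrix.mul_assoc,
          Matrix.mul_assoc, h3, map_mul, map_mul, Pi.mul_apply])
  rw [LinearMap.trace_conj', hT1] at hT2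
  rw [columnSum_eq_sum_trace e, hT2]
  refine Finset.sum_congr rfl fun i _ => ?_
  rw [hJsymm, Matrix.mul_assoc, Matrix.nonsing_inv_mul _ (hJdet i), Matrix.mul_one]

/-! ### Counting summands by characters -/

section Multiplicity

variable {G : Type*} [Group G] [Finite G] {V : Type*} [AddCommGroup V] [Module ℂ V]

/-- An irreducible character has scalar product one with the sum of all irreducible characters. -/
theorem sum_columnSum_mul_character_of_isIrreducible [Fintype G] (ρ : Representation ℂ G V)
    (hρ : ρ.IsIrreducible) :
    (Nat.card G : ℂ)⁻¹ * ∑ g : G, columnSum g⁻¹ * ρ.character g = 1 := by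
  obtain ⟨n, d, hd, ⟨e⟩⟩ :=
    IsSemisimpleRing.exists_algEquiv_pi_matrix_of_isAlgClosed ℂ (MonoidAlgebra ℂ G)
  have hInv : Invertible (Nat.card G : ℂ) := invertibleOfNonzero (by simp)
  have hirr := blockRep_isIrreducible e
  obtain ⟨i₀, ⟨f⟩⟩ := exists_equiv_blockRep e ρ hρ
  simp only [columnSum_eq_sum_trace e, ← blockRep_character, Finset.sum_mul]
  rw [Finset.sum_comm, Finset.mul_sum, ← Representation.char_iso f]
  rw [Finset.sum_eq_single i₀]
  · have := Representation.char_orthonormal (blockRep e i₀) (blockRep e i₀)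
    rw [if_pos ⟨Representation.Equiv.refl _⟩] at this
    simpa only [mul_comm] using this
  · intro i _ hi
    have := Representation.char_orthonormal (blockRep e i₀) (blockRep e i)
    rw [if_neg (not_nonempty_iff.mpr (blockRep_isEmpty_equiv e hi))] at this
    simpa only [mul_comm] using this
  · simp

theorem IsIndecomposable.isSimpleModule {R M : Type*} [Ring R] [AddCommGroup M] [Module R M]
    [IsSemisimpleModule R M] (h : IsIndecomposable R M) : IsSimpleModule R M := by
  have := h.1
  rw [isSimpleModule_iff]
  refine ⟨fun P => ?_⟩
  obtain ⟨Q, hPQ⟩ := exists_isCompl P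
  rcases h.2 P Q hPQ with hP | hQ
  · exact Or.inl hP
  · right
    rw [hQ] at hPQ
    simpa using hPQ.sup_eq_top

theorem IsIndecomposable.of_isSimpleModule {R M : Type*} [Ring R] [AddCommGroup M] [Module R M]
    [IsSimpleModule R M] : IsIndecomposable R M := by
  refine ⟨IsSimpleModule.nontrivial R M, fun P Q hPQ => ?_⟩
  rcases eq_bot_or_eq_top P with hP | hP
  · exact Or.inl hP
  · right
    rw [hP] at hPQ
    simpa using hPQ.inf_eq_bot

theorem HasIndecomposableDecomposition.length_eq {R M : Type*} [Ring R] [AddCommGroup M]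
    [Module R M] [IsSemisimpleModule R M] {k : ℕ} (h : HasIndecomposableDecomposition R M k) :
    Module.length R M = k := by
  obtain ⟨N, hN, hind⟩ := h
  have e := (LinearEquiv.ofBijective (DirectSum.coeLinearMap N) hN).symm.trans
    (DirectSum.linearEquivFunOnFintype R (Fin k) (fun i => N i))
  rw [e.length_eq, Module.length_pi_of_fintype]
  have : ∀ i, Module.length R (N i) = 1 := fun i =>
    Module.length_eq_one_iff.mpr (hind i).isSimpleModule
  simp [this]

theorem exists_hasIndecomposableDecomposition (R M : Type*) [Ring R] [AddCommGroup M]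
    [Module R M] [IsSemisimpleModule R M] [Module.Finite R M] :
    ∃ k, HasIndecomposableDecomposition R M k := by
  obtain ⟨s, hind, hsup, hs⟩ := IsSemisimpleModule.exists_sSupIndep_sSup_simples_eq_top R M
  rw [sSupIndep_iff] at hind
  have hfin : Finite s := WellFoundedGT.finite_of_iSupIndep hind fun m =>
    (Submodule.nontrivial_iff_ne_bot).mp (have := hs m m.2; IsSimpleModule.nontrivial R m.1)
  let e := (Finite.equivFin s).symm
  refine ⟨Nat.card s, fun i => (e i : Submodule R M), ?_, fun i => ?_⟩
  · rw [DirectSum.isInternal_submodule_iff_iSupIndep_and_iSup_eq_top]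
    refine ⟨hind.comp e.injective, ?_⟩
    rw [e.iSup_comp (g := fun m : s => (m : Submodule R M)), ← sSup_eq_iSup', hsup]
  · have := hs (e i) (e i).2
    exact IsIndecomposable.of_isSimpleModule

theorem HasIndecomposableDecomposition.eq_sum_character [Fintype G]
    [FiniteDimensional ℂ V] (ρ : Representation ℂ G V)
    {k : ℕ} (h : HasIndecomposableDecomposition (MonoidAlgebra ℂ G) ρ.asModule k) :
    (k : ℂ) = (Nat.card G : ℂ)⁻¹ * ∑ g : G, columnSum g⁻¹ * ρ.character g := by
  obtain ⟨N, hN, hind⟩ := h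
  let U : Fin k → Subrepresentation ρ := fun i => Subrepresentation.ofSubmodule' (N i)
  have hU : ∀ i, (U i).toRepresentation.IsIrreducible := fun i => by
    refine (U i).toRepresentation_isIrreducible ?_
    exact (OrderIso.isAtom_iff (Subrepresentation.subrepresentationSubmoduleOrderIso (ρ := ρ).symm)
      (N i)).mpr (isSimpleModule_iff_isAtom.mp (hind i).isSimpleModule)
  have hint : DirectSum.IsInternal fun i => (U i).toSubmodule := hN
  have hchar : ∀ g, ρ.character g = ∑ i, (U i).toRepresentation.character g := fun g =>
    LinearMap.trace_eq_sum_trace_restrict hint fun i => (U i).apply_mem_toSubmodule g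
  simp_rw [hchar, Finset.mul_sum]
  rw [Finset.sum_comm]
  simp_rw [← Finset.mul_sum]
  rw [Finset.mul_sum, Finset.sum_congr rfl fun i _ =>
    sum_columnSum_mul_character_of_isIrreducible (U i).toRepresentation (hU i)]
  simp

theorem hasIndecomposableDecomposition_iff [FiniteDimensional ℂ V] (ρ : Representation ℂ G V) (k : ℕ) :
    HasIndecomposableDecomposition (MonoidAlgebra ℂ G) ρ.asModule k ↔
      k = numIndecomposableSummands (MonoidAlgebra ℂ G) ρ.asModule := by
  have hfin : Module.Finite (MonoidAlgebra ℂ G) ρ.asModule :=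
    Module.Finite.of_restrictScalars_finite ℂ _ _
  obtain ⟨k₀, hk₀⟩ := exists_hasIndecomposableDecomposition (MonoidAlgebra ℂ G) ρ.asModule
  have huniq : ∀ k, HasIndecomposableDecomposition (MonoidAlgebra ℂ G) ρ.asModule k → k = k₀ := by
    intro k hk
    have := hk.length_eq.symm.trans hk₀.length_eq
    exact_mod_cast this
  -- The length of the module determines the number of summands, so the infimum defining `b(n)` is
  -- taken over a singleton.
  have hset : {k | HasIndecomposableDecomposition (MonoidAlgebra ℂ G) ρ.asModule k} = {k₀} :=
    Set.eq_singleton_iff_unique_mem.mpr ⟨hk₀, huniq⟩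
  rw [numIndecomposableSummands, hset, csInf_singleton]
  exact ⟨huniq k, fun h => h ▸ hk₀⟩

end Multiplicity

theorem character_tensorPower {G : Type*} [Group G] {V : Type*} [AddCommGroup V] [Module ℂ V]
    [FiniteDimensional ℂ V] (ρ : Representation ℂ G V) (n : ℕ) (g : G) :
    (tensorPower ρ n).character g = ρ.character g ^ n := by
  classical
  let b := Module.finBasis ℂ V
  rw [Representation.character, Representation.character,
    LinearMap.trace_eq_matrix_trace ℂ (Basis.piTensorProduct fun _ : Fin n => b),
    LinearMap.trace_eq_matrix_trace ℂ b, Matrix.trace, Matrix.trace, Fintype.sum_pow]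
  refine Finset.sum_congr rfl fun p _ => ?_
  rw [Matrix.diag_apply, LinearMap.toMatrix_apply, Basis.piTensorProduct_apply]
  change (Basis.piTensorProduct fun _ : Fin n => b).repr
    (PiTensorProduct.map (fun _ => ρ g) _) p = _
  rw [PiTensorProduct.map_tprod, Basis.piTensorProduct_repr_tprod_apply]
  simp [LinearMap.toMatrix_apply]

/-! ### Reversing the cycles of a permutation -/

section Reversal

open Equiv Equiv.Perm

variable {α : Type*}

/-- A base point in the cycle of `i`, equal to `i₀` for the cycle of `i₀`. -/
noncomputable def cycleBase (π : Perm α) (i₀ i : α) : α :=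
  open Classical in
  if π.SameCycle i₀ i then i₀ else (Quotient.mk (SameCycle.setoid π) i).out

theorem sameCycle_cycleBase (π : Perm α) (i₀ i : α) : π.SameCycle (cycleBase π i₀ i) i := by
  unfold cycleBase
  split_ifs with h
  · exact h
  · exact Quotient.mk_out (s := SameCycle.setoid π) i

theorem cycleBase_eq {π : Perm α} {i₀ i j : α} (h : π.SameCycle i j) :
    cycleBase π i₀ i = cycleBase π i₀ j := by
  unfold cycleBase
  have h1 : π.SameCycle i₀ i ↔ π.SameCycle i₀ j := ⟨fun a => a.trans h, fun a => a.trans h.symm⟩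
  have h2 : Quotient.mk (SameCycle.setoid π) i = Quotient.mk (SameCycle.setoid π) j :=
    Quotient.sound h
  rw [h2]
  by_cases hc : π.SameCycle i₀ i
  · rw [if_pos hc, if_pos (h1.mp hc)]
  · rw [if_neg hc, if_neg (fun h => hc (h1.mpr h))]

theorem cycleBase_self (π : Perm α) (i₀ : α) : cycleBase π i₀ i₀ = i₀ := by
  unfold cycleBase
  rw [if_pos (SameCycle.refl π i₀)]

theorem cycleBase_apply (π : Perm α) (i₀ i : α) : cycleBase π i₀ (π i) = cycleBase π i₀ i :=
  cycleBase_eq (sameCycle_apply_left.mpr (SameCycle.refl π i))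

/-- The diagonal part of an element conjugating a monomial matrix to its transpose. -/
noncomputable def reversalWeight {A : Type*} [CommGroup A] (f : α → A) (π : Perm α) (c : α)
    (k : ℕ) : A :=
  ∏ j ∈ Finset.range k, f ((π ^ (-(j : ℤ))) c) / f ((π ^ (j + 1)) c)

/-- After a full turn, numerators and denominators run through the same points of the cycle in
opposite orders. This is what makes the weight consistent when the index wraps to `0`. -/
theorem reversalWeight_of_pow_eq {A : Type*} [CommGroup A] (f : α → A) {π : Perm α} {c : α}
    {k : ℕ} (h : (π ^ k) c = c) : reversalWeight f π c k = 1 := by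
  rw [reversalWeight, Finset.prod_div_distrib, div_eq_one, ← Finset.prod_range_reflect]
  refine Finset.prod_congr rfl fun j hj => ?_
  rw [Finset.mem_range] at hj
  congr 1
  have : (-((k - 1 - j : ℕ) : ℤ)) = ((j + 1 : ℕ) : ℤ) - k := by omega
  rw [this, sub_eq_add_neg, zpow_add, mul_apply, zpow_natCast, zpow_neg, zpow_natCast]
  congr 1
  rw [inv_eq_iff_eq, h]

variable [Finite α]

theorem exists_pow_cycleBase (π : Perm α) (i₀ i : α) : ∃ k : ℕ, (π ^ k) (cycleBase π i₀ i) = i := by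
  obtain ⟨k, -, hk⟩ := (sameCycle_cycleBase π i₀ i).exists_pow_eq'
  exact ⟨k, hk⟩

open Classical in
/-- The position of `i` in its cycle, counted from the base point. -/
noncomputable def cycleIndex (π : Perm α) (i₀ i : α) : ℕ := Nat.find (exists_pow_cycleBase π i₀ i)

theorem pow_cycleIndex (π : Perm α) (i₀ i : α) :
    (π ^ cycleIndex π i₀ i) (cycleBase π i₀ i) = i := by
  classical
  exact Nat.find_spec (exists_pow_cycleBase π i₀ i)

theorem cycleIndex_le {π : Perm α} {i₀ i : α} {k : ℕ} (h : (π ^ k) (cycleBase π i₀ i) = i) :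
    cycleIndex π i₀ i ≤ k := by
  classical
  exact Nat.find_min' _ h

theorem cycleIndex_apply (π : Perm α) (i₀ i : α) :
    cycleIndex π i₀ (π i) = cycleIndex π i₀ i + 1 ∨
      (cycleIndex π i₀ (π i) = 0 ∧
        (π ^ (cycleIndex π i₀ i + 1)) (cycleBase π i₀ i) = cycleBase π i₀ i) := by
  have h1 : (π ^ (cycleIndex π i₀ i + 1)) (cycleBase π i₀ i) = π i := by
    rw [pow_succ', mul_apply, pow_cycleIndex]
  have h2 : cycleIndex π i₀ (π i) ≤ cycleIndex π i₀ i + 1 :=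
    cycleIndex_le (by rw [cycleBase_apply, h1])
  have h3 := pow_cycleIndex π i₀ (π i)
  rw [cycleBase_apply] at h3
  rcases h : cycleIndex π i₀ (π i) with _ | k
  · right
    rw [h] at h3
    exact ⟨rfl, h1.trans h3.symm⟩
  · left
    rw [h, pow_succ', mul_apply] at h3
    have := cycleIndex_le (π.injective h3)
    omega

/-- The involution reversing each cycle of `π` about its base point. -/
noncomputable def cycleReversalFun (π : Perm α) (i₀ i : α) : α :=
  (π ^ (-(cycleIndex π i₀ i : ℤ))) (cycleBase π i₀ i)

/-- The reversal negates exponents relative to the base point, whichever exponent represents the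
given point. -/
theorem cycleReversalFun_zpow (π : Perm α) (i₀ i : α) (n : ℤ) :
    cycleReversalFun π i₀ ((π ^ n) (cycleBase π i₀ i)) = (π ^ (-n)) (cycleBase π i₀ i) := by
  set c := cycleBase π i₀ i with hc
  set j := (π ^ n) c with hj
  have h1 : cycleBase π i₀ j = c := cycleBase_eq
    (((sameCycle_zpow_left).mpr (SameCycle.refl π c)).trans (sameCycle_cycleBase π i₀ i))
  have h2 := pow_cycleIndex π i₀ j
  rw [h1] at h2
  unfold cycleReversalFun
  rw [h1]
  set k := cycleIndex π i₀ j
  have h3 : (π ^ ((k : ℤ) - n)) c = c := by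
    rw [sub_eq_neg_add, zpow_add, mul_apply, zpow_natCast, h2, hj, ← mul_apply, ← zpow_add]
    simp
  calc (π ^ (-(k : ℤ))) c = (π ^ (-(k : ℤ))) ((π ^ ((k : ℤ) - n)) c) := by rw [h3]
    _ = (π ^ (-n)) c := by rw [← mul_apply, ← zpow_add]; congr 2; ring

theorem cycleReversalFun_involutive (π : Perm α) (i₀ : α) :
    Function.Involutive (cycleReversalFun π i₀) := by
  intro i
  have h := cycleReversalFun_zpow π i₀ i (-(cycleIndex π i₀ i : ℤ))
  rw [neg_neg, zpow_natCast] at h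
  refine h.trans ?_
  exact pow_cycleIndex π i₀ i

/-- The involution reversing each cycle of `π` about its base point, as a permutation. -/
noncomputable def cycleReversal (π : Perm α) (i₀ : α) : Perm α :=
  (cycleReversalFun_involutive π i₀).toPerm

theorem cycleReversal_apply_eq (π : Perm α) (i₀ i : α) :
    cycleReversal π i₀ i = (π ^ (-(cycleIndex π i₀ i : ℤ))) (cycleBase π i₀ i) := rfl

theorem cycleReversal_apply (π : Perm α) (i₀ i : α) :
    cycleReversal π i₀ (π i) = π⁻¹ (cycleReversal π i₀ i) := by
  have h : π i = (π ^ ((cycleIndex π i₀ i : ℤ) + 1)) (cycleBase π i₀ i) := by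
    rw [add_comm, zpow_add, mul_apply, zpow_natCast, pow_cycleIndex, zpow_one]
  have h1 : cycleReversal π i₀ (π i) = cycleReversalFun π i₀ (π i) := rfl
  rw [h1, h, cycleReversalFun_zpow, cycleReversal_apply_eq, ← mul_apply, ← zpow_neg_one,
    ← zpow_add]
  congr 2
  ring

theorem cycleReversal_base (π : Perm α) (i₀ : α) : cycleReversal π i₀ i₀ = i₀ := by
  have := cycleReversalFun_zpow π i₀ i₀ 0
  rw [cycleBase_self] at this
  simp only [neg_zero, zpow_zero, one_apply] at this
  exact this

theorem cycleReversal_of_fixed {π : Perm α} (i₀ : α) {i : α} (h : π i = i) :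
    cycleReversal π i₀ i = i := by
  have h1 : cycleBase π i₀ i = i := by
    obtain ⟨k, hk⟩ := (sameCycle_cycleBase π i₀ i).symm
    rw [zpow_apply_eq_self_of_apply_eq_self h] at hk
    exact hk.symm
  rw [cycleReversal_apply_eq, h1, zpow_apply_eq_self_of_apply_eq_self h]

/-- This recursion is the diagonal part of the equation `gᵀ l = l g`. Along a cycle it holds by the
defining product; at the wrap-around the full product is `1`. -/
theorem reversalWeight_cycleIndex_apply {A : Type*} [CommGroup A] (f : α → A) (π : Perm α)
    (i₀ i : α) :
    reversalWeight f π (cycleBase π i₀ (π i)) (cycleIndex π i₀ (π i)) * f (π i) =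
      reversalWeight f π (cycleBase π i₀ i) (cycleIndex π i₀ i) * f (cycleReversal π i₀ i) := by
  have h1 : (π ^ (cycleIndex π i₀ i + 1)) (cycleBase π i₀ i) = π i := by
    rw [pow_succ', mul_apply, pow_cycleIndex]
  have h2 : reversalWeight f π (cycleBase π i₀ i) (cycleIndex π i₀ (π i)) =
      reversalWeight f π (cycleBase π i₀ i) (cycleIndex π i₀ i + 1) := by
    rcases cycleIndex_apply π i₀ i with h | ⟨h, h'⟩
    · rw [h]
    · rw [h, reversalWeight_of_pow_eq f h']
      rfl
  rw [cycleBase_apply, h2, reversalWeight, Finset.prod_range_succ, h1, mul_assoc, div_mul_cancel]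
  rfl

end Reversal

/-! ### Monomial matrices and their transpose -/

section Wreath

variable {A ι : Type*} [CommGroup A]

/-- The wreath product `A ≀ Sym(ι)`, a group of monomial matrices. -/
abbrev Monomial (A ι : Type*) [CommGroup A] : Type _ :=
  (ι → A) ⋊[mulAutArrow (G := Equiv.Perm ι) (A := ι) (M := A)] Equiv.Perm ι

instance [Finite A] [Finite ι] : Finite (Monomial A ι) :=
  Finite.of_equiv _ SemidirectProduct.equivProd.symm

/-- The transpose of a monomial matrix. -/
def transpose (g : Monomial A ι) : Monomial A ι := ⟨fun i => g.left (g.right i), g.right⁻¹⟩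

theorem monomial_mul_left (g h : Monomial A ι) (i : ι) :
    (g * h).left i = g.left i * h.left (g.right⁻¹ i) := rfl

theorem monomial_mul_right (g h : Monomial A ι) : (g * h).right = g.right * h.right := rfl

theorem transpose_involutive : Function.Involutive (transpose : Monomial A ι → Monomial A ι) := by
  intro g
  refine SemidirectProduct.ext ?_ ?_
  · funext i
    simp [transpose]
  · simp [transpose]

theorem transpose_mul (g h : Monomial A ι) : transpose (g * h) = transpose h * transpose g := by
  refine SemidirectProduct.ext ?_ ?_
  · funext i
    simp [transpose, monomial_mul_left, mul_comm]
  · simp [transpose]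

/-- A monomial matrix is conjugate to its transpose by a monomial matrix whose permutation fixes a
prescribed point and all points fixed by the given matrix. -/
theorem exists_conj_transpose [Finite ι] (g : Monomial A ι) (i₀ : ι) :
    ∃ l : Monomial A ι, transpose g = l * g * l⁻¹ ∧ l.right i₀ = i₀ ∧
      ∀ i, g.right i = i → l.right i = i := by
  set π := g.right with hπ
  set ρ := cycleReversal π i₀
  let w : ι → A := fun i => reversalWeight g.left π (cycleBase π i₀ i) (cycleIndex π i₀ i)
  have hw : ∀ i, w (π i) * g.left (π i) = w i * g.left (ρ i) :=
    reversalWeight_cycleIndex_apply g.left π i₀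
  -- The permutation part reverses cycles, so it conjugates `π` to `π⁻¹`; basing the cycle of `i₀`
  -- at `i₀` makes it fix `i₀`.
  refine ⟨⟨fun i => w (ρ⁻¹ i), ρ⟩, ?_, cycleReversal_base π i₀,
    fun i hi => cycleReversal_of_fixed i₀ hi⟩
  rw [eq_mul_inv_iff_mul_eq]
  have hρπ : ∀ i, ρ (π i) = π⁻¹ (ρ i) := cycleReversal_apply π i₀
  have hright : π⁻¹ * ρ = ρ * π := Equiv.ext fun i => (hρπ i).symm
  refine SemidirectProduct.ext ?_ hright
  funext j
  obtain ⟨i, rfl⟩ : ∃ i, ρ (π i) = j := ⟨π⁻¹ (ρ⁻¹ j), by simp⟩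
  simp only [monomial_mul_left, transpose]
  rw [← hπ, inv_inv, hρπ i]
  have e1 : π (π⁻¹ (ρ i)) = ρ i := π.apply_symm_apply _
  have e2 : ρ⁻¹ (ρ i) = i := ρ.symm_apply_apply _
  have e3 : ρ⁻¹ (π⁻¹ (ρ i)) = π i := by rw [← hρπ]; exact ρ.symm_apply_apply _
  rw [e1, e2, e3, hw, mul_comm]

variable (A) in
/-- The monomial matrices whose permutation fixes all points from `j` on. -/
def fixingFrom {r : ℕ} (j : ℕ) : Subgroup (Monomial A (Fin r)) where
  carrier := {g | ∀ i : Fin r, j ≤ i → g.right i = i}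
  one_mem' := fun i _ => rfl
  mul_mem' := fun {a b} ha hb i hi => by
    rw [monomial_mul_right, Equiv.Perm.mul_apply, hb i hi, ha i hi]
  inv_mem' := fun {a} ha i hi => by
    rw [SemidirectProduct.inv_right, Equiv.Perm.inv_eq_iff_eq, ha i hi]

/-- The transpose on the monomial matrices whose permutation fixes all points from `j` on. -/
def transposeFixing {r : ℕ} (j : ℕ) (g : fixingFrom A (r := r) j) : fixingFrom A (r := r) j :=
  ⟨transpose g.1, fun i hi => by
    change (g.1.right)⁻¹ i = i
    rw [Equiv.Perm.inv_eq_iff_eq, g.2 i hi]⟩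

theorem transposeFixing_involutive {r : ℕ} (j : ℕ) :
    Function.Involutive (transposeFixing (A := A) (r := r) j) :=
  fun g => Subtype.ext (transpose_involutive g.1)

/-- For `j = 0` the matrices are diagonal and equal their transposes, so the trivial group suffices
for the descent. For the step, the conjugator is based at the point `j`: it fixes `j` and everything
`g` fixes, so it lies in the smaller subgroup. -/
theorem hasAnisotropicForms_fixingFrom [Finite A] {r : ℕ} (j : ℕ) (hj : j ≤ r) :
    HasAnisotropicForms (fixingFrom A (r := r) j) (transposeFixing j) := by
  induction j with
  | zero =>
    refine HasAnisotropicForms.of_conj (1 : Unit →* _) id _ (fun _ => ?_) (fun _ => rfl)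
      (fun a b => Subtype.ext (transpose_mul a.1 b.1)) (fun g => ?_)
      (HasAnisotropicForms.of_subsingleton _)
    · rfl
    · refine ⟨1, ?_⟩
      have h1 : g.1.right = 1 := Equiv.ext fun i => g.2 i (Nat.zero_le _)
      simp only [MonoidHom.one_apply, one_mul, inv_one, mul_one]
      refine Subtype.ext (SemidirectProduct.ext ?_ ?_)
      · funext i
        simp [transposeFixing, transpose, h1]
      · simp [transposeFixing, transpose, h1]
  | succ j ih =>
    have hle : fixingFrom A (r := r) j ≤ fixingFrom A (j + 1) :=
      fun g hg i hi => hg i (by omega)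
    refine HasAnisotropicForms.of_conj (Subgroup.inclusion hle) (transposeFixing j) _
      (fun _ => rfl) (transposeFixing_involutive j)
      (fun a b => Subtype.ext (transpose_mul a.1 b.1))
      (fun g => ?_) (ih (by omega))
    obtain ⟨l, hl, hl0, hfix⟩ := exists_conj_transpose g.1 ⟨j, hj⟩
    refine ⟨⟨l, fun i hi => ?_⟩, Subtype.ext hl⟩
    rcases Nat.eq_or_lt_of_le hi with h | h
    · rwa [show i = ⟨j, hj⟩ from Fin.ext h.symm]
    · exact hfix i (g.2 i h)

theorem hasAnisotropicForms_monomial [Finite A] {r : ℕ} :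
    HasAnisotropicForms (Monomial A (Fin r)) transpose := by
  rcases Nat.eq_zero_or_pos r with rfl | hr
  · have : Subsingleton (Monomial A (Fin 0)) :=
      ⟨fun a b => SemidirectProduct.ext (Subsingleton.elim _ _) (Subsingleton.elim _ _)⟩
    exact HasAnisotropicForms.of_subsingleton _
  refine HasAnisotropicForms.of_conj (fixingFrom A (r := r) r).subtype (transposeFixing r) _
    (fun _ => rfl) (transposeFixing_involutive r) transpose_mul (fun g => ?_)
    (hasAnisotropicForms_fixingFrom r le_rfl)
  obtain ⟨l, hl, -⟩ := exists_conj_transpose g ⟨0, hr⟩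
  exact ⟨⟨l, fun i hi => absurd i.2 (by omega)⟩, hl⟩

theorem columnSum_monomial [Finite A] {r : ℕ} (hr : 1 ≤ r) (x : Monomial A (Fin r)) :
    columnSum x = (Nat.card {g : Monomial A (Fin r) // x * transpose g = g} : ℂ) :=
  hasAnisotropicForms_monomial.columnSum_eq transpose_involutive transpose_mul
    (fun g => let ⟨l, hl, _⟩ := exists_conj_transpose g ⟨0, hr⟩; ⟨l, hl⟩) x

end Wreath

/-! ### Counting solutions of `x gᵀ = g` for scalar `x` -/

section Counting

open Equiv Equiv.Perm

/-- The points with `i ≤ ρ i` represent the orbits of the involution: each transposition loses one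
point. -/
theorem card_transversal {r : ℕ} {ρ : Perm (Fin r)} (hρ : ρ ^ 2 = 1) :
    Nat.card {i // i ≤ ρ i} = r - ρ.cycleType.card := by
  have hinv : ∀ i, ρ (ρ i) = i := fun i => by rw [← mul_apply, ← pow_two, hρ, one_apply]
  have h2 : ρ.support.card = 2 * ρ.cycleType.card := by
    have : Fact (Nat.Prime 2) := ⟨Nat.prime_two⟩
    rw [← sum_cycleType, Multiset.eq_replicate.mpr ⟨rfl, pow_prime_eq_one_iff.mp hρ⟩]
    simp [mul_comm]
  have h3 : (Finset.univ.filter fun i => i < ρ i).card =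
      (Finset.univ.filter fun i => ρ i < i).card := by
    refine Finset.card_bij (fun i _ => ρ i) (fun i hi => ?_) (fun i _ j _ h => ρ.injective h)
      fun i hi => ⟨ρ i, ?_, hinv i⟩
    · simpa [hinv] using hi
    · simpa [hinv] using hi
  have h4 : ρ.support.card = (Finset.univ.filter fun i => i < ρ i).card +
      (Finset.univ.filter fun i => ρ i < i).card := by
    rw [← Finset.card_union_of_disjoint]
    · congr 1
      ext i
      simp only [mem_support, Finset.mem_union, Finset.mem_filter, Finset.mem_univ, true_and]
      rw [ne_iff_lt_or_gt, or_comm]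
    · rw [Finset.disjoint_filter]
      exact fun i _ h => not_lt_of_gt h
  have h5 : (Finset.univ.filter fun i => i ≤ ρ i).card +
      (Finset.univ.filter fun i => ρ i < i).card = r := by
    simp_rw [← not_le]
    rw [Finset.card_filter_add_card_filter_not, Finset.card_univ, Fintype.card_fin]
  rw [Nat.card_eq_fintype_card, Fintype.card_subtype]
  omega

/-- Such a `u` is freely determined by its values on the points with `i ≤ ρ i`. A fixed point of `ρ`
would force `a = 1`, hence the alternative in `hfix`. -/
theorem card_twisted_invariant {A : Type*} [CommGroup A] [Finite A] {r : ℕ} {ρ : Perm (Fin r)}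
    (hρ : ρ ^ 2 = 1) {a : A} (ha : a ^ 2 = 1) (hfix : a = 1 ∨ ∀ i, ρ i ≠ i) :
    Nat.card {u : Fin r → A // ∀ i, a * u (ρ i) = u i} = Nat.card A ^ (r - ρ.cycleType.card) := by
  have hinv : ∀ i, ρ (ρ i) = i := fun i => by rw [← mul_apply, ← pow_two, hρ, one_apply]
  have haa : a * a = 1 := by rw [← pow_two, ha]
  let e : {u : Fin r → A // ∀ i, a * u (ρ i) = u i} ≃ ({i // i ≤ ρ i} → A) :=
    { toFun := fun u i => u.1 i.1
      invFun := fun v => ⟨fun i => if h : i ≤ ρ i then v ⟨i, h⟩ else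
          a * v ⟨ρ i, by rw [hinv]; exact (not_le.mp h).le⟩, fun i => by
        dsimp only
        rcases lt_trichotomy i (ρ i) with h | h | h
        · rw [dif_neg (by rw [hinv]; exact not_le.mpr h), dif_pos h.le, ← mul_assoc, haa, one_mul]
          congr 1
          exact Subtype.ext (hinv i)
        · rcases hfix with h1 | h1
          · rw [h1, one_mul, dif_pos (by rw [hinv]; exact h.ge), dif_pos h.le]
            congr 1
            exact Subtype.ext h.symm
          · exact absurd h.symm (h1 i)
        · rw [dif_pos (by rw [hinv]; exact h.le), dif_neg (not_le.mpr h)]⟩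
      left_inv := fun u => by
        refine Subtype.ext (funext fun i => ?_)
        by_cases h : i ≤ ρ i
        · simp [h]
        · simp [h, u.2]
      right_inv := fun v => by
        funext i
        simp [i.2] }
  rw [Nat.card_congr e, Nat.card_fun, card_transversal hρ]

theorem card_mul_transpose_eq {A : Type*} [CommGroup A] [Finite A] {r : ℕ} (x : Monomial A (Fin r)) :
    Nat.card {g : Monomial A (Fin r) // x * transpose g = g} =
      ∑ ρ : Perm (Fin r), Nat.card {u : Fin r → A // x * transpose ⟨u, ρ⟩ = ⟨u, ρ⟩} := by
  let e : {g : Monomial A (Fin r) // x * transpose g = g} ≃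
      Σ ρ : Perm (Fin r), {u : Fin r → A // x * transpose ⟨u, ρ⟩ = ⟨u, ρ⟩} :=
    { toFun := fun g => ⟨g.1.right, g.1.left, g.2⟩
      invFun := fun p => ⟨⟨p.2.1, p.1⟩, p.2.2⟩
      left_inv := fun g => rfl
      right_inv := fun p => rfl }
  rw [Nat.card_congr e, Nat.card_sigma]

/-- The scalar monomial matrix with entry `a`. -/
def scalarMatrix {A : Type*} [CommGroup A] (r : ℕ) (a : A) : Monomial A (Fin r) := ⟨fun _ => a, 1⟩

theorem scalarMatrix_mul_transpose_iff {A : Type*} [CommGroup A] {r : ℕ} (a : A) (u : Fin r → A)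
    (ρ : Perm (Fin r)) :
    scalarMatrix r a * transpose ⟨u, ρ⟩ = ⟨u, ρ⟩ ↔ ρ ^ 2 = 1 ∧ ∀ i, a * u (ρ i) = u i := by
  rw [SemidirectProduct.ext_iff, and_comm, pow_two, funext_iff]
  refine and_congr ?_ ?_
  · change 1 * ρ⁻¹ = ρ ↔ _
    rw [one_mul, inv_eq_iff_mul_eq_one]
  · rfl

/-- The number of involutions (possibly trivial) with a given number of transpositions. -/
theorem card_cycleType_replicate_two (r k : ℕ) (hk : 2 * k ≤ r) :
    ((Finset.univ.filter fun ρ : Perm (Fin r) => ρ.cycleType = Multiset.replicate k 2).card : ℂ) =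
      r.factorial / ((r - 2 * k).factorial * k.factorial * 2 ^ k) := by
  have h := card_of_cycleType_mul_eq (Fin r) (Multiset.replicate k 2)
  rw [if_pos ⟨by simpa [mul_comm] using hk, fun a ha => (Multiset.eq_of_mem_replicate ha).ge⟩] at h
  have h1 : ∏ n ∈ (Multiset.replicate k 2).toFinset, ((Multiset.replicate k 2).count n).factorial =
      k.factorial := by
    rcases Nat.eq_zero_or_pos k with rfl | hk0
    · simp
    · rw [Multiset.toFinset_replicate, if_neg hk0.ne']
      simp
  rw [h1, Multiset.sum_replicate, Multiset.prod_replicate, Fintype.card_fin, smul_eq_mul,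
    mul_comm k 2] at h
  rw [eq_div_iff (mul_ne_zero (mul_ne_zero (Nat.cast_ne_zero.mpr (Nat.factorial_ne_zero _))
    (Nat.cast_ne_zero.mpr (Nat.factorial_ne_zero _))) (pow_ne_zero _ two_ne_zero)), ← h]
  push_cast
  ring

theorem sq_eq_one_iff_cycleType {r : ℕ} (ρ : Perm (Fin r)) :
    ρ ^ 2 = 1 ↔ ρ.cycleType = Multiset.replicate ρ.cycleType.card 2 := by
  have : Fact (Nat.Prime 2) := ⟨Nat.prime_two⟩
  rw [pow_prime_eq_one_iff, Multiset.eq_replicate]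
  simp

theorem two_mul_card_cycleType_le {r : ℕ} {ρ : Perm (Fin r)} {k : ℕ}
    (h : ρ.cycleType = Multiset.replicate k 2) : 2 * k ≤ r := by
  have h1 := ρ.support.card_le_univ
  rw [← sum_cycleType, h, Multiset.sum_replicate, Fintype.card_fin, smul_eq_mul] at h1
  omega

/-- Summing a function of the number of transpositions over all involutions. -/
theorem sum_involutions {r : ℕ} (F : ℕ → ℂ) :
    ∑ ρ : Perm (Fin r), (if ρ ^ 2 = 1 then F ρ.cycleType.card else 0) =
      ∑ k ∈ Finset.range (r / 2 + 1),
        r.factorial / ((r - 2 * k).factorial * k.factorial * 2 ^ k) * F k := by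
  have h1 : ∀ ρ : Perm (Fin r), (if ρ ^ 2 = 1 then F ρ.cycleType.card else 0) =
      ∑ k ∈ Finset.range (r / 2 + 1),
        if ρ.cycleType = Multiset.replicate k 2 then F k else 0 := by
    intro ρ
    split_ifs with h
    · rw [sq_eq_one_iff_cycleType] at h
      rw [Finset.sum_eq_single ρ.cycleType.card, if_pos h]
      · intro k _ hk
        rw [if_neg fun h' => hk (by rw [h', Multiset.card_replicate])]
      · intro hn
        have := two_mul_card_cycleType_le h
        exact absurd (Finset.mem_range.mpr (by omega)) hn
    · refine (Finset.sum_eq_zero fun k _ => if_neg fun h' => h ?_).symm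
      rw [sq_eq_one_iff_cycleType, h', Multiset.card_replicate]
  rw [Finset.sum_congr rfl fun ρ _ => h1 ρ, Finset.sum_comm]
  refine Finset.sum_congr rfl fun k hk => ?_
  rw [Finset.mem_range] at hk
  rw [← Finset.sum_filter, Finset.sum_const, nsmul_eq_mul, card_cycleType_replicate_two r k (by omega)]

variable {A : Type*} [CommGroup A] [Finite A] {r : ℕ}

theorem card_scalarMatrix_one :
    (Nat.card {g : Monomial A (Fin r) // scalarMatrix r (1 : A) * transpose g = g} : ℂ) =
      ∑ k ∈ Finset.range (r / 2 + 1),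
        r.factorial / ((r - 2 * k).factorial * k.factorial * 2 ^ k) * (Nat.card A : ℂ) ^ (r - k) := by
  rw [card_mul_transpose_eq, ← sum_involutions fun k => (Nat.card A : ℂ) ^ (r - k), Nat.cast_sum]
  refine Finset.sum_congr rfl fun ρ _ => ?_
  simp only [scalarMatrix_mul_transpose_iff]
  split_ifs with h
  · simp only [h, true_and]
    rw [card_twisted_invariant h (one_pow 2) (Or.inl rfl), Nat.cast_pow]
  · simp [h]

/-- At a fixed point of `ρ` the equation would read `a u_i = u_i`, so only fixed-point-free
involutions contribute, and these have exactly `r / 2` transpositions. -/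
theorem card_scalarMatrix_of_ne_one {a : A} (ha : a ≠ 1) (ha2 : a ^ 2 = 1) :
    (Nat.card {g : Monomial A (Fin r) // scalarMatrix r a * transpose g = g} : ℂ) =
      if Even r then
        r.factorial / ((r / 2).factorial * 2 ^ (r / 2)) * (Nat.card A : ℂ) ^ (r / 2) else 0 := by
  have h1 : (Nat.card {g : Monomial A (Fin r) // scalarMatrix r a * transpose g = g} : ℂ) =
      ∑ k ∈ Finset.range (r / 2 + 1), r.factorial / ((r - 2 * k).factorial * k.factorial * 2 ^ k) *
        (if r = 2 * k then (Nat.card A : ℂ) ^ k else 0) := by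
    rw [card_mul_transpose_eq, ← sum_involutions fun k => if r = 2 * k then (Nat.card A : ℂ) ^ k
      else 0, Nat.cast_sum]
    refine Finset.sum_congr rfl fun ρ _ => ?_
    simp only [scalarMatrix_mul_transpose_iff]
    by_cases h : ρ ^ 2 = 1
    · simp only [h, true_and, if_true]
      have hs : ρ.support.card = 2 * ρ.cycleType.card := by
        rw [← sum_cycleType, (sq_eq_one_iff_cycleType ρ).mp h]
        simp [mul_comm]
      split_ifs with hr
      · have hfix : ∀ i, ρ i ≠ i := by
          have : ρ.support = Finset.univ := by
            rw [← Finset.card_eq_iff_eq_univ, hs, Fintype.card_fin, ← hr]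
          intro i
          rw [← mem_support, this]
          exact Finset.mem_univ i
        rw [card_twisted_invariant h ha2 (Or.inr hfix), Nat.cast_pow]
        congr 1
        omega
      · obtain ⟨i, hi⟩ : ∃ i, ρ i = i := by
          by_contra! hcon
          have : ρ.support = Finset.univ := by
            ext i; simp [hcon]
          rw [this, Finset.card_univ, Fintype.card_fin] at hs
          exact hr hs
        rw [Nat.cast_eq_zero, Nat.card_eq_zero]
        left
        refine ⟨fun u => ha ?_⟩
        have := u.2 i
        rwa [hi, mul_eq_right] at this
    · simp [h]
  rw [h1]
  split_ifs with hr
  · obtain ⟨s, hs⟩ := hr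
    have hs2 : r / 2 = s := by omega
    rw [hs2, Finset.sum_eq_single s]
    · rw [if_pos (by omega), show r - 2 * s = 0 by omega]
      simp
    · intro k _ hk
      rw [if_neg (by omega), mul_zero]
    · simp
  · refine Finset.sum_eq_zero fun k _ => ?_
    rw [if_neg fun h => hr ⟨k, by omega⟩, mul_zero]

end Counting

/-! ### Asymptotics of tensor powers -/

section Growth

variable {G : Type*} [Group G] {V : Type*} [AddCommGroup V] [Module ℂ V]

theorem ActsAsScalar.spec {ρ : Representation ℂ G V} {g : G} (h : ActsAsScalar ρ g) :
    ρ g = scalarOf ρ g • LinearMap.id := by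
  rw [scalarOf, dif_pos h]
  exact h.choose_spec

theorem scalarOf_eq [Nontrivial V] {ρ : Representation ℂ G V} {g : G} {c : ℂ}
    (h : ρ g = c • LinearMap.id) : scalarOf ρ g = c := by
  have h1 : ActsAsScalar ρ g := ⟨c, h⟩
  obtain ⟨v, hv⟩ := exists_ne (0 : V)
  have h2 := LinearMap.congr_fun (h1.spec.symm.trans h) v
  exact smul_left_injective ℂ hv h2

theorem ActsAsScalar.commute {ρ : Representation ℂ G V} (hρ : Function.Injective ρ) {g : G}
    (h : ActsAsScalar ρ g) (x : G) : g * x = x * g := by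
  apply hρ
  rw [map_mul, map_mul, h.spec]
  ext v
  simp

theorem actsAsScalar_of_commute [FiniteDimensional ℂ V] {ρ : Representation ℂ G V} (hρ : ρ.IsIrreducible) {g : G}
    (h : ∀ x, g * x = x * g) : ActsAsScalar ρ g := by
  let T : Representation.IntertwiningMap ρ ρ :=
    LinearMap.intertwiningMap_of_isIntertwiningMap ρ ρ (ρ g) fun x v => by
      rw [← Module.End.mul_apply, ← map_mul, h, map_mul, Module.End.mul_apply]
  obtain ⟨c, hc⟩ :=
    Representation.IsIrreducible.algebraMap_intertwiningMap_bijective_of_isAlgClosed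
      (ρ := ρ) |>.2 T
  refine ⟨c, ?_⟩
  have := congrArg Representation.IntertwiningMap.toLinearMap hc
  exact this.symm

theorem ActsAsScalar.character_eq [FiniteDimensional ℂ V] {ρ : Representation ℂ G V} {g : G} (h : ActsAsScalar ρ g) :
    ρ.character g = scalarOf ρ g * Module.finrank ℂ V := by
  rw [Representation.character, h.spec, map_smul, LinearMap.trace_id, smul_eq_mul]

open Classical in
theorem asymptoticFormula_eq [Fintype G] {ρ : Representation ℂ G V} (hρ : Function.Injective ρ)
    (n : ℕ) : asymptoticFormula ρ n = (Nat.card G : ℂ)⁻¹ *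
      ∑ g : G with ActsAsScalar ρ g,
        columnSum g⁻¹ * scalarOf ρ g ^ n * (Module.finrank ℂ V : ℂ) ^ n := by
  have hmk : ∀ c : ConjClasses G, ConjClasses.mk (classRep c) = c := fun c => Quotient.out_eq c
  -- By faithfulness an element acting as a scalar is central, so its class is a singleton and the
  -- chosen representative is the element itself.
  have hrep : ∀ g, ActsAsScalar ρ g → classRep (ConjClasses.mk g) = g := fun g hg => by
    have h1 : IsConj (classRep (ConjClasses.mk g)) g := ConjClasses.mk_eq_mk_iff_isConj.mp (hmk _)
    obtain ⟨x, hx⟩ := isConj_iff.mp h1.symm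
    rw [← hx, ← hg.commute hρ, mul_inv_cancel_right]
  rw [asymptoticFormula, one_div]
  congr 1
  have hbij : Set.BijOn (classRep (G := G)) {c | ActsAsScalar ρ (classRep c)}
      {g | ActsAsScalar ρ g} := by
    refine ⟨fun c hc => hc, fun c _ c' _ h => ?_, fun g hg => ⟨ConjClasses.mk g, ?_, hrep g hg⟩⟩
    · rw [← hmk c, ← hmk c', h]
    · change ActsAsScalar ρ _
      rwa [hrep g hg]
  rw [finsum_mem_eq_of_bijOn (g := fun g : G =>
    columnSum g⁻¹ * scalarOf ρ g ^ n * (Module.finrank ℂ V : ℂ) ^ n) _ hbij fun c _ => rfl]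
  rw [← finsum_mem_coe_finset]
  simp

variable [Finite G] [FiniteDimensional ℂ V]

/-- An element of a finite group not acting as a scalar has character value of absolute value
smaller than the dimension. -/
theorem norm_character_lt (ρ : Representation ℂ G V) {g : G} (hg : ¬ ActsAsScalar ρ g) :
    ‖ρ.character g‖ < Module.finrank ℂ V := by
  classical
  set f : Module.End ℂ V := ρ g with hf
  set N := orderOf g with hN
  have hN0 : 0 < N := orderOf_pos g
  have hfN : f ^ N = 1 := by rw [hf, ← map_pow, pow_orderOf_eq_one, map_one]
  have hss : f.IsSemisimple := by
    refine Module.End.isSemisimple_of_squarefree_aeval_eq_zero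
      (p := Polynomial.X ^ N - Polynomial.C (1 : ℂ)) ?_ ?_
    · exact (Polynomial.separable_X_pow_sub_C 1 (by exact_mod_cast hN0.ne') one_ne_zero).squarefree
    · simp [hfN]
  have hint : DirectSum.IsInternal fun μ => f.eigenspace μ := by
    rw [DirectSum.isInternal_submodule_iff_iSupIndep_and_iSup_eq_top]
    exact ⟨f.eigenspaces_iSupIndep, hss.iSup_eigenspace_eq_top⟩
  have hfin : {μ | f.eigenspace μ ≠ ⊥}.Finite :=
    WellFoundedGT.finite_ne_bot_of_iSupIndep f.eigenspaces_iSupIndep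
  set S := hfin.toFinset with hS
  have htr : ρ.character g = ∑ μ ∈ S, (Module.finrank ℂ (f.eigenspace μ) : ℂ) * μ := by
    have hmaps : ∀ μ, Set.MapsTo f (f.eigenspace μ) (f.eigenspace μ) := fun μ v hv => by
      rw [SetLike.mem_coe, Module.End.mem_eigenspace_iff] at hv
      rw [hv]
      exact (f.eigenspace μ).smul_mem _ (Module.End.mem_eigenspace_iff.mpr hv)
    rw [Representation.character, ← hf, LinearMap.trace_eq_sum_trace_restrict' hint hfin hmaps]
    refine Finset.sum_congr rfl fun μ _ => ?_
    have : f.restrict (hmaps μ) = μ • LinearMap.id := by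
      ext v
      exact Module.End.mem_eigenspace_iff.mp v.2
    rw [this, map_smul, LinearMap.trace_id, smul_eq_mul, mul_comm]
  have hdim : (Module.finrank ℂ V : ℝ) = ∑ μ ∈ S, (Module.finrank ℂ (f.eigenspace μ) : ℝ) := by
    have h1 := LinearMap.trace_eq_sum_trace_restrict' hint hfin (f := LinearMap.id)
      fun μ v hv => hv
    rw [LinearMap.trace_id] at h1
    have h2 : ∀ μ, LinearMap.trace ℂ (f.eigenspace μ)
        ((LinearMap.id : V →ₗ[ℂ] V).restrict fun v (hv : v ∈ f.eigenspace μ) => hv) =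
          Module.finrank ℂ (f.eigenspace μ) := fun μ => LinearMap.trace_id _ _
    rw [Finset.sum_congr rfl fun μ _ => h2 μ] at h1
    exact_mod_cast h1
  have hnorm : ∀ μ ∈ S, ‖μ‖ = 1 := fun μ hμ => by
    rw [hS, Set.Finite.mem_toFinset] at hμ
    obtain ⟨v, hv, hv0⟩ := Submodule.exists_mem_ne_zero_of_ne_bot hμ
    have h1 : f.HasEigenvector μ v := ⟨hv, hv0⟩
    have h2 := h1.pow_apply N
    rw [hfN, Module.End.one_apply] at h2
    refine Complex.norm_eq_one_of_pow_eq_one (n := N) ?_ hN0.ne'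
    by_contra hne
    refine hv0 ((smul_eq_zero.mp (?_ : (μ ^ N - 1) • v = 0)).resolve_left (sub_ne_zero.mpr hne))
    rw [sub_smul, one_smul, ← h2, sub_self]
  have hpos : ∀ μ ∈ S, (0 : ℝ) < Module.finrank ℂ (f.eigenspace μ) := fun μ hμ => by
    rw [hS, Set.Finite.mem_toFinset] at hμ
    have := (Submodule.nontrivial_iff_ne_bot).mpr hμ
    exact_mod_cast Module.finrank_pos
  have htop : ∀ μ, f.eigenspace μ ≠ ⊤ := fun μ h => hg ⟨μ, LinearMap.ext fun v => by
    have : v ∈ f.eigenspace μ := h ▸ Submodule.mem_top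
    exact Module.End.mem_eigenspace_iff.mp this⟩
  -- The operator is diagonalizable and not scalar, so no single eigenvalue exhausts the spectrum.
  have hex : ∀ μ, ∃ ν ∈ S, ν ≠ μ := fun μ => by
    by_contra! hcon
    refine htop μ (top_unique ?_)
    rw [← hss.iSup_eigenspace_eq_top]
    refine iSup_le fun ν => ?_
    by_cases hν : f.eigenspace ν = ⊥
    · rw [hν]; exact bot_le
    · rw [hcon ν (by rw [hS, Set.Finite.mem_toFinset]; exact hν)]
  obtain ⟨μ, hμ, -⟩ := hex 0
  obtain ⟨ν, hν, hνμ⟩ := hex μ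
  have hν' : ν ∈ S.erase μ := Finset.mem_erase.mpr ⟨hνμ, hν⟩
  rw [htr, hdim, ← Finset.add_sum_erase S _ hμ, ← Finset.add_sum_erase S _ hμ,
    ← Finset.add_sum_erase _ _ hν', ← Finset.add_sum_erase _ _ hν', ← add_assoc, ← add_assoc]
  have hterm : ∀ κ ∈ S, ‖(Module.finrank ℂ (f.eigenspace κ) : ℂ) * κ‖ =
      Module.finrank ℂ (f.eigenspace κ) := fun κ hκ => by
    rw [norm_mul, hnorm κ hκ, mul_one, Complex.norm_natCast]
  have hrest : ‖∑ κ ∈ (S.erase μ).erase ν, (Module.finrank ℂ (f.eigenspace κ) : ℂ) * κ‖ ≤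
      ∑ κ ∈ (S.erase μ).erase ν, (Module.finrank ℂ (f.eigenspace κ) : ℝ) := by
    refine (norm_sum_le _ _).trans (Finset.sum_le_sum fun κ hκ => (hterm κ ?_).le)
    exact Finset.mem_of_mem_erase (Finset.mem_of_mem_erase hκ)
  -- Two distinct numbers of norm one are not on the same ray, so the triangle inequality is strict
  -- for this pair.
  have hstrict : ‖(Module.finrank ℂ (f.eigenspace μ) : ℂ) * μ +
      (Module.finrank ℂ (f.eigenspace ν) : ℂ) * ν‖ <
      Module.finrank ℂ (f.eigenspace μ) + Module.finrank ℂ (f.eigenspace ν) := by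
    rw [← hterm μ hμ, ← hterm ν hν]
    refine norm_add_lt_of_not_sameRay fun hray => hνμ ?_
    have e : ∀ κ, (Module.finrank ℂ (f.eigenspace κ) : ℂ) * κ =
        (Module.finrank ℂ (f.eigenspace κ) : ℝ) • κ := fun κ => by simp
    rw [e, e] at hray
    have h1 := (hray.pos_smul_left (inv_pos.mpr (hpos μ hμ))).pos_smul_right
      (inv_pos.mpr (hpos ν hν))
    rw [inv_smul_smul₀ (hpos μ hμ).ne', inv_smul_smul₀ (hpos ν hν).ne',
      sameRay_iff_of_norm_eq ((hnorm μ hμ).trans (hnorm ν hν).symm)] at h1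
    exact h1.symm
  exact (norm_add_le _ _).trans_lt (add_lt_add_of_lt_of_le hstrict hrest)

theorem numSummands_eq [Fintype G] (ρ : Representation ℂ G V) (n : ℕ) :
    (numSummands ρ n : ℂ) = (Nat.card G : ℂ)⁻¹ * ∑ g : G, columnSum g⁻¹ * ρ.character g ^ n := by
  rw [numSummands,
    ((hasIndecomposableDecomposition_iff (tensorPower ρ n) _).mpr rfl).eq_sum_character]
  simp only [character_tensorPower]

/-- After division by `(dim V)^n` the error is a finite combination of powers of numbers of norm
less than one; `hbound` keeps the denominator from decaying or vanishing. -/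
theorem tendsto_numSummands_div {ρ : Representation ℂ G V} [Nontrivial V]
    (hρ : Function.Injective ρ) {δ : ℝ} (hδ : 0 < δ)
    (hbound : ∀ n, δ * (Module.finrank ℂ V : ℝ) ^ n ≤ ‖asymptoticFormula ρ n‖) :
    Filter.Tendsto (fun n : ℕ => (numSummands ρ n : ℂ) / asymptoticFormula ρ n)
      Filter.atTop (nhds 1) := by
  classical
  have hFin : Fintype G := Fintype.ofFinite G
  set d := Module.finrank ℂ V with hd
  have hd0 : (0 : ℝ) < d := by exact_mod_cast Module.finrank_pos
  have hdc : (d : ℂ) ≠ 0 := by exact_mod_cast hd0.ne'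
  let ε : ℕ → ℂ := fun n => (Nat.card G : ℂ)⁻¹ *
    ∑ g : G with ¬ ActsAsScalar ρ g, columnSum g⁻¹ * (ρ.character g / d) ^ n
  have hε : Filter.Tendsto ε Filter.atTop (nhds 0) := by
    have : Filter.Tendsto ε Filter.atTop (nhds ((Nat.card G : ℂ)⁻¹ *
        ∑ g : G with ¬ ActsAsScalar ρ g, columnSum g⁻¹ * 0)) := by
      refine Filter.Tendsto.const_mul _ (tendsto_finsetSum _ fun g hg => ?_)
      refine Filter.Tendsto.const_mul _ (tendsto_pow_atTop_nhds_zero_of_norm_lt_one ?_)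
      rw [norm_div, Complex.norm_natCast, div_lt_one hd0]
      exact norm_character_lt ρ (Finset.mem_filter.mp hg).2
    simpa using this
  have hdiff : ∀ n, (numSummands ρ n : ℂ) = asymptoticFormula ρ n + ε n * d ^ n := by
    intro n
    rw [numSummands_eq, asymptoticFormula_eq hρ, ← Finset.sum_filter_add_sum_filter_not
      Finset.univ (fun g => ActsAsScalar ρ g), mul_add]
    congr 1
    · congr 1
      refine Finset.sum_congr rfl fun g hg => ?_
      rw [(Finset.mem_filter.mp hg).2.character_eq, mul_pow, mul_assoc]
    · simp only [ε]
      rw [mul_assoc, Finset.sum_mul]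
      congr 1
      refine Finset.sum_congr rfl fun g _ => ?_
      rw [mul_assoc, ← mul_pow, div_mul_cancel₀ _ hdc]
  have ha : ∀ n, asymptoticFormula ρ n ≠ 0 := fun n h => by
    have := hbound n
    rw [h, norm_zero] at this
    exact absurd this (not_le.mpr (by positivity))
  have hratio : ∀ n, (numSummands ρ n : ℂ) / asymptoticFormula ρ n =
      1 + ε n * d ^ n / asymptoticFormula ρ n := fun n => by
    rw [hdiff, add_div, div_self (ha n)]
  simp only [hratio]
  rw [show (1 : ℂ) = 1 + 0 by simp]
  refine Filter.Tendsto.add (by simp) (squeeze_zero_norm (a := fun n => ‖ε n‖ / δ) (fun n => ?_) ?_)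
  · rw [norm_div, norm_mul, norm_pow, Complex.norm_natCast,
      div_le_div_iff₀ (norm_pos_iff.mpr (ha n)) hδ, mul_assoc, mul_comm _ δ]
    exact mul_le_mul_of_nonneg_left (hbound n) (norm_nonneg _)
  · simpa using hε.norm.div_const δ

end Growth

/-! ### Central elements and their column sums -/

section Center

variable {A : Type*} [CommGroup A] {r : ℕ}

/-- A central permutation that is a square is trivial. -/
theorem eq_one_of_central_of_sq {π ρ : Equiv.Perm (Fin r)} (hc : ∀ σ, π * σ = σ * π)
    (h : π = ρ ^ 2) : π = 1 := by
  by_contra hne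
  obtain ⟨i, hi⟩ : ∃ i, π i ≠ i := by
    by_contra! hcon
    exact hne (Equiv.ext hcon)
  -- Commuting with the transposition of `π i` and any third point would fail at `i`, so only two
  -- points exist, and a nontrivial permutation of two points is not a square.
  have honly : ∀ k, k = i ∨ k = π i := by
    intro k
    by_contra! hk
    have h1 := Equiv.congr_fun (hc (Equiv.swap (π i) k)) i
    rw [Equiv.Perm.mul_apply, Equiv.Perm.mul_apply, Equiv.swap_apply_of_ne_of_ne hi.symm hk.1.symm,
      Equiv.swap_apply_left] at h1
    exact hk.2 h1.symm
  have hsq : ρ (ρ i) = π i := by rw [h, pow_two, Equiv.Perm.mul_apply]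
  rcases honly (ρ i) with h1 | h1
  · rw [h1, h1] at hsq
    exact hi hsq.symm
  · rcases honly (ρ (ρ i)) with h2 | h2
    · exact hi (hsq.symm.trans h2)
    · exact hi (h1.symm.trans (ρ.injective (h2.trans h1.symm)))

/-- A central monomial matrix `x` such that `x gᵀ = g` for some `g` is a scalar of square one. -/
theorem exists_eq_scalarMatrix (hr : 1 ≤ r) {x g : Monomial A (Fin r)} (hx : ∀ y, x * y = y * x)
    (hg : x * transpose g = g) : ∃ a : A, a ^ 2 = 1 ∧ x = scalarMatrix r a := by
  have hright : x.right = g.right ^ 2 := by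
    have h1 := congrArg SemidirectProduct.right hg
    change x.right * g.right⁻¹ = g.right at h1
    rw [pow_two]
    exact mul_inv_eq_iff_eq_mul.mp h1
  have hxr : x.right = 1 := eq_one_of_central_of_sq
    (fun σ => congrArg SemidirectProduct.right (hx ⟨1, σ⟩)) hright
  have hconst : ∀ i j, x.left i = x.left j := by
    intro i j
    have h1 := congrFun (congrArg SemidirectProduct.left (hx ⟨1, Equiv.swap i j⟩)) i
    rw [monomial_mul_left, monomial_mul_left] at h1
    simpa using h1
  have hxs : x = scalarMatrix r (x.left ⟨0, hr⟩) :=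
    SemidirectProduct.ext (funext fun i => hconst _ _) hxr
  refine ⟨x.left ⟨0, hr⟩, ?_, hxs⟩
  set a := x.left ⟨0, hr⟩
  rw [hxs] at hg
  obtain ⟨h1, h2⟩ := (scalarMatrix_mul_transpose_iff a g.left g.right).mp hg
  have h3 := h2 ⟨0, hr⟩
  rw [← h2 (g.right ⟨0, hr⟩), ← Equiv.Perm.mul_apply, ← pow_two, h1, Equiv.Perm.one_apply,
    ← mul_assoc, ← pow_two] at h3
  exact mul_eq_right.mp h3

theorem scalarMatrix_commute (a : A) (y : Monomial A (Fin r)) :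
    scalarMatrix r a * y = y * scalarMatrix r a :=
  SemidirectProduct.ext (funext fun i => mul_comm _ _) (by simp [scalarMatrix])

theorem scalarMatrix_one : scalarMatrix r (1 : A) = 1 := rfl

theorem scalarMatrix_mul (a b : A) :
    (scalarMatrix r a * scalarMatrix r b : Monomial A (Fin r)) = scalarMatrix r (a * b) := rfl

theorem scalarMatrix_injective (hr : 1 ≤ r) :
    Function.Injective (scalarMatrix r : A → Monomial A (Fin r)) := fun _ _ h =>
  congrFun (congrArg SemidirectProduct.left h) ⟨0, hr⟩

theorem scalarMatrix_inv {a : A} (ha : a ^ 2 = 1) :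
    (scalarMatrix r a)⁻¹ = scalarMatrix r a := by
  rw [inv_eq_iff_mul_eq_one, scalarMatrix_mul, ← pow_two, ha, scalarMatrix_one]

theorem card_monomial [Finite A] :
    (Nat.card (Monomial A (Fin r)) : ℂ) = (Nat.card A : ℂ) ^ r * r.factorial := by
  rw [SemidirectProduct.card, Nat.card_fun, Nat.card_perm]
  simp

variable {V : Type*} [AddCommGroup V] [Module ℂ V]

theorem columnSum_inv_eq_zero [Finite A] (hr : 1 ≤ r) {g : Monomial A (Fin r)}
    (hg : ∀ y, g * y = y * g) (h : ∀ a : A, a ^ 2 = 1 → g ≠ scalarMatrix r a) :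
    columnSum g⁻¹ = 0 := by
  rw [columnSum_monomial hr, Nat.cast_eq_zero, Nat.card_eq_zero]
  left
  refine ⟨fun u => ?_⟩
  have hc : ∀ y, g⁻¹ * y = y * g⁻¹ := fun y => (Commute.inv_left (hg y) : Commute g⁻¹ y)
  obtain ⟨a, ha, hga⟩ := exists_eq_scalarMatrix hr hc u.2
  apply h a ha
  rw [← inv_inv g, hga, scalarMatrix_inv ha]

theorem scalarOf_one [Nontrivial V] {G : Type*} [Group G] (ρ : Representation ℂ G V) :
    scalarOf ρ 1 = 1 :=
  scalarOf_eq (by rw [map_one, one_smul]; rfl)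

/-- The scalar squares to `1`, and faithfulness excludes `1` itself. -/
theorem scalarOf_eq_neg_one [Nontrivial V] {G : Type*} [Group G] {ρ : Representation ℂ G V}
    (hρ : Function.Injective ρ) {g : G} (hg : ActsAsScalar ρ g) (h1 : g ≠ 1) (h2 : g ^ 2 = 1) :
    scalarOf ρ g = -1 := by
  have h3 : ρ (g ^ 2) = (scalarOf ρ g ^ 2) • LinearMap.id := by
    rw [map_pow, hg.spec, smul_pow]
    rfl
  have h4 : scalarOf ρ g ^ 2 = 1 := by rw [← scalarOf_eq h3, h2, scalarOf_one]
  refine (eq_or_eq_neg_of_sq_eq_sq _ 1 (by rw [h4, one_pow])).resolve_left fun h5 => ?_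
  apply h1
  apply hρ
  rw [hg.spec, h5, map_one, one_smul]
  rfl

theorem sq_eq_one_zmod {m : ℕ} {a : Multiplicative (ZMod m)} (ha : a ^ 2 = 1) :
    a = 1 ∨ (Even m ∧ a = Multiplicative.ofAdd ((m / 2 : ℕ) : ZMod m)) := by
  have h1 : -a.toAdd = a.toAdd := by
    have : a.toAdd + a.toAdd = 0 := by
      rw [pow_two] at ha
      exact congrArg Multiplicative.toAdd ha
    exact neg_eq_of_add_eq_zero_left this
  rcases (ZMod.neg_eq_self_iff _).mp h1 with h | h
  · exact Or.inl h
  · right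
    rcases Nat.eq_zero_or_pos m with rfl | hm
    · exact ⟨Even.zero, by simpa using h⟩
    have := NeZero.of_pos hm
    refine ⟨⟨a.toAdd.val, by omega⟩, ?_⟩
    have h2 : m / 2 = a.toAdd.val := by omega
    rw [h2, ZMod.natCast_zmod_val]
    rfl

theorem half_sq_eq_one {m : ℕ} (hm : Even m) :
    (Multiplicative.ofAdd ((m / 2 : ℕ) : ZMod m)) ^ 2 = 1 := by
  obtain ⟨s, rfl⟩ := hm
  rw [pow_two, ← ofAdd_add, ← Nat.cast_add, show (s + s) / 2 + (s + s) / 2 = s + s by omega,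
    ZMod.natCast_self]
  rfl

theorem half_ne_one {m : ℕ} (hm : 1 ≤ m) (hm2 : Even m) :
    Multiplicative.ofAdd ((m / 2 : ℕ) : ZMod m) ≠ 1 := by
  obtain ⟨s, rfl⟩ := hm2
  intro h
  have h1 : (((s + s) / 2 : ℕ) : ZMod (s + s)) = 0 := h
  rw [ZMod.natCast_eq_zero_iff] at h1
  have := Nat.le_of_dvd (by omega) h1
  omega

/-- The elements contributing to the asymptotic formula are the two scalar matrices `±1`. -/
theorem asymptoticFormula_eq_columnSum {m r : ℕ} (hm : 1 ≤ m) (hr : 1 ≤ r) [FiniteDimensional ℂ V]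
    (ρ : Representation ℂ (GeneralizedSymmetricGroup m r) V)
    (hfaithful : Function.Injective ρ) (hsimple : ρ.IsIrreducible) [Nontrivial V] (n : ℕ) :
    asymptoticFormula ρ n = (Nat.card (GeneralizedSymmetricGroup m r) : ℂ)⁻¹ *
      (columnSum (1 : GeneralizedSymmetricGroup m r) +
        if Even m then columnSum (scalarMatrix r (Multiplicative.ofAdd ((m / 2 : ℕ) : ZMod m))) *
          (-1) ^ n else 0) * (Module.finrank ℂ V : ℂ) ^ n := by
  classical
  have : NeZero m := NeZero.of_pos hm
  have hFin : Fintype (GeneralizedSymmetricGroup m r) := Fintype.ofFinite _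
  set z : GeneralizedSymmetricGroup m r :=
    scalarMatrix r (Multiplicative.ofAdd ((m / 2 : ℕ) : ZMod m)) with hz
  have hscal : ∀ a : Multiplicative (ZMod m), ActsAsScalar ρ (scalarMatrix r a) := fun a =>
    actsAsScalar_of_commute hsimple fun y => scalarMatrix_commute a y
  rw [asymptoticFormula_eq hfaithful, mul_assoc]
  congr 1
  by_cases hm2 : Even m
  · have hz1 : z ≠ 1 := fun h => half_ne_one hm hm2 (scalarMatrix_injective hr h)
    have hzz : z ^ 2 = 1 := by
      rw [pow_two, hz, scalarMatrix_mul, ← pow_two, half_sq_eq_one hm2, scalarMatrix_one]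
    -- Every other element acting as a scalar is central but not a scalar matrix of square one, so
    -- its column sum is zero.
    rw [← Finset.sum_subset (s₁ := {1, z})]
    · rw [Finset.sum_pair hz1.symm, scalarOf_one,
        scalarOf_eq_neg_one hfaithful (hscal _) hz1 hzz, if_pos hm2, inv_one, one_pow,
        hz, scalarMatrix_inv (half_sq_eq_one hm2)]
      ring
    · intro g hg
      rw [Finset.mem_insert, Finset.mem_singleton] at hg
      refine Finset.mem_filter.mpr ⟨Finset.mem_univ _, ?_⟩
      rcases hg with rfl | rfl
      · exact hscal 1
      · exact hscal _
    · intro g hg hg'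
      rw [columnSum_inv_eq_zero hr (fun y => (Finset.mem_filter.mp hg).2.commute hfaithful y),
        zero_mul, zero_mul]
      intro a ha hga
      apply hg'
      rw [Finset.mem_insert, Finset.mem_singleton, hga]
      rcases sq_eq_one_zmod ha with rfl | ⟨-, rfl⟩
      · exact Or.inl rfl
      · exact Or.inr rfl
  · rw [← Finset.sum_subset (s₁ := {1})]
    · rw [Finset.sum_singleton, scalarOf_one, if_neg hm2, inv_one, one_pow]
      ring
    · intro g hg
      rw [Finset.mem_singleton] at hg
      refine Finset.mem_filter.mpr ⟨Finset.mem_univ _, ?_⟩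
      rw [hg]
      exact hscal 1
    · intro g hg hg'
      rw [columnSum_inv_eq_zero hr (fun y => (Finset.mem_filter.mp hg).2.commute hfaithful y),
        zero_mul, zero_mul]
      intro a ha hga
      apply hg'
      rw [Finset.mem_singleton, hga]
      rcases sq_eq_one_zmod ha with rfl | ⟨h, -⟩
      · rfl
      · exact absurd h hm2

theorem columnSum_one_div {m r : ℕ} (hm : 1 ≤ m) (hr : 1 ≤ r) :
    (Nat.card (GeneralizedSymmetricGroup m r) : ℂ)⁻¹ *
      columnSum (1 : GeneralizedSymmetricGroup m r) =
      ∑ k ∈ Finset.range (r / 2 + 1),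
        1 / (((r - 2 * k).factorial : ℂ) * k.factorial * 2 ^ k * (m : ℂ) ^ k) := by
  have : NeZero m := NeZero.of_pos hm
  have hm0 : (m : ℂ) ≠ 0 := Nat.cast_ne_zero.mpr (by omega)
  have hfac : ∀ k : ℕ, (k.factorial : ℂ) ≠ 0 := fun k =>
    Nat.cast_ne_zero.mpr (Nat.factorial_ne_zero k)
  have hcard : Nat.card (Multiplicative (ZMod m)) = m := Nat.card_zmod m
  rw [columnSum_monomial hr, ← scalarMatrix_one, card_scalarMatrix_one, card_monomial, hcard,
    Finset.mul_sum]
  refine Finset.sum_congr rfl fun k hk => ?_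
  have hk' : k ≤ r := by
    rw [Finset.mem_range] at hk
    omega
  obtain ⟨s, rfl⟩ := Nat.exists_eq_add_of_le hk'
  rw [show k + s - k = s by omega, pow_add]
  field_simp [hfac]

theorem columnSum_half_div {m r : ℕ} (hm : 1 ≤ m) (hr : 1 ≤ r) (hm2 : Even m) :
    (Nat.card (GeneralizedSymmetricGroup m r) : ℂ)⁻¹ *
      columnSum (scalarMatrix r (Multiplicative.ofAdd ((m / 2 : ℕ) : ZMod m))) =
      if Even r then 1 / ((r / 2).factorial * (m : ℂ) ^ r) * ((m : ℂ) / 2) ^ (r / 2) else 0 := by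
  have : NeZero m := NeZero.of_pos hm
  have hm0 : (m : ℂ) ≠ 0 := Nat.cast_ne_zero.mpr (by omega)
  have hfac : ∀ k : ℕ, (k.factorial : ℂ) ≠ 0 := fun k =>
    Nat.cast_ne_zero.mpr (Nat.factorial_ne_zero k)
  have hcard : Nat.card (Multiplicative (ZMod m)) = m := Nat.card_zmod m
  rw [columnSum_monomial hr, card_scalarMatrix_of_ne_one (half_ne_one hm hm2) (half_sq_eq_one hm2),
    card_monomial, hcard]
  split_ifs with hr2
  · have := hfac r
    have := hfac (r / 2)
    rw [div_pow]
    field_simp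
  · rw [mul_zero]

end Center

/-! ### Closed form and lower bound for `a(n)` -/

/-- The closed form of `a(n)`. -/
theorem asymptoticFormula_closed_form {m r : ℕ} (hm : 1 ≤ m) (hr : 1 ≤ r)
    {V : Type*} [AddCommGroup V] [Module ℂ V] [FiniteDimensional ℂ V] [Nontrivial V]
    (ρ : Representation ℂ (GeneralizedSymmetricGroup m r) V)
    (hfaithful : Function.Injective ρ) (hsimple : ρ.IsIrreducible) (n : ℕ) :
    asymptoticFormula ρ n =
      if Even r ∧ Even m then
        ((∑ k ∈ Finset.range (r / 2 + 1),
            1 / ((m : ℂ) ^ k * (r - 2 * k).factorial * k.factorial * 2 ^ k)) +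
          1 / ((r / 2).factorial * (m : ℂ) ^ r) * ((m : ℂ) / 2) ^ (r / 2) * (-1) ^ n) *
          (Module.finrank ℂ V : ℂ) ^ n
      else
        (∑ k ∈ Finset.range (r / 2 + 1),
            1 / (((r - 2 * k).factorial : ℂ) * k.factorial * 2 ^ k * (m : ℂ) ^ k)) *
          (Module.finrank ℂ V : ℂ) ^ n := by
  rw [asymptoticFormula_eq_columnSum hm hr ρ hfaithful hsimple, mul_add, columnSum_one_div hm hr]
  by_cases hm2 : Even m
  · rw [if_pos hm2, ← mul_assoc, columnSum_half_div hm hr hm2]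
    by_cases hr2 : Even r
    · rw [if_pos hr2, if_pos ⟨hr2, hm2⟩]
      congr 2
      refine Finset.sum_congr rfl fun k _ => ?_
      congr 1
      ring
    · rw [if_neg hr2, if_neg fun h => hr2 h.1, zero_mul, add_zero]
  · rw [if_neg hm2, if_neg fun h => hm2 h.2, mul_zero, add_zero]

/-- The constant `1 / r!` is the `k = 0` term of the sum. When `r` and `m` are even, the alternating
term has the same absolute value as the `k = r / 2` term, so at worst it cancels that one; as `r ≥
2`, the `k = 0` term survives. -/
theorem le_norm_asymptoticFormula {m r : ℕ} (hm : 1 ≤ m) (hr : 1 ≤ r)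
    {V : Type*} [AddCommGroup V] [Module ℂ V] [FiniteDimensional ℂ V] [Nontrivial V]
    (ρ : Representation ℂ (GeneralizedSymmetricGroup m r) V)
    (hfaithful : Function.Injective ρ) (hsimple : ρ.IsIrreducible) (n : ℕ) :
    1 / (r.factorial : ℝ) * (Module.finrank ℂ V : ℝ) ^ n ≤ ‖asymptoticFormula ρ n‖ := by
  have hm0 : (0 : ℝ) < m := by exact_mod_cast hm
  rw [asymptoticFormula_closed_form hm hr ρ hfaithful hsimple]
  split_ifs with h
  · obtain ⟨s, hs⟩ := h.1
    have hs2 : r / 2 = s := by omega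
    have hcast : (((∑ k ∈ Finset.range (r / 2 + 1),
            1 / ((m : ℂ) ^ k * (r - 2 * k).factorial * k.factorial * 2 ^ k)) +
          1 / ((r / 2).factorial * (m : ℂ) ^ r) * ((m : ℂ) / 2) ^ (r / 2) * (-1) ^ n)) =
        (((∑ k ∈ Finset.range (r / 2 + 1),
            1 / ((m : ℝ) ^ k * (r - 2 * k).factorial * k.factorial * 2 ^ k)) +
          1 / ((r / 2).factorial * (m : ℝ) ^ r) * ((m : ℝ) / 2) ^ (r / 2) * (-1) ^ n : ℝ) : ℂ) := by
      push_cast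
      rfl
    rw [hcast, norm_mul, norm_pow, Complex.norm_natCast, Complex.norm_real]
    refine mul_le_mul_of_nonneg_right (le_trans ?_ (Real.le_norm_self _)) (by positivity)
    set T : ℝ := 1 / ((r / 2).factorial * (m : ℝ) ^ r) * ((m : ℝ) / 2) ^ (r / 2) with hT
    have hT0 : 0 ≤ T := by positivity
    have hlast : 1 / ((m : ℝ) ^ (r / 2) * (r - 2 * (r / 2)).factorial * (r / 2).factorial *
        2 ^ (r / 2)) = T := by
      rw [hT, hs2, show r - 2 * s = 0 by omega, hs, pow_add, div_pow]
      have : (s.factorial : ℝ) ≠ 0 := Nat.cast_ne_zero.mpr (Nat.factorial_ne_zero s)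
      simp only [Nat.factorial_zero, Nat.cast_one]
      field_simp
    have hsign : -T ≤ T * (-1) ^ n := by
      rcases neg_one_pow_eq_or ℝ n with h1 | h1 <;> rw [h1] <;> linarith
    have hfirst : 1 / (r.factorial : ℝ) ≤ ∑ k ∈ Finset.range (r / 2),
        1 / ((m : ℝ) ^ k * (r - 2 * k).factorial * k.factorial * 2 ^ k) := by
      refine le_trans (le_of_eq ?_) (Finset.single_le_sum (fun k _ => by positivity)
        (Finset.mem_range.mpr (show 0 < r / 2 by omega)))
      simp
    rw [Finset.sum_range_succ, hlast]
    linarith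
  · have hcast : (∑ k ∈ Finset.range (r / 2 + 1),
            1 / (((r - 2 * k).factorial : ℂ) * k.factorial * 2 ^ k * (m : ℂ) ^ k)) =
        ((∑ k ∈ Finset.range (r / 2 + 1),
            1 / (((r - 2 * k).factorial : ℝ) * k.factorial * 2 ^ k * (m : ℝ) ^ k) : ℝ) : ℂ) := by
      push_cast
      rfl
    rw [hcast, norm_mul, norm_pow, Complex.norm_natCast, Complex.norm_real]
    refine mul_le_mul_of_nonneg_right (le_trans ?_ (Real.le_norm_self _)) (by positivity)
    refine le_trans (le_of_eq ?_) (Finset.single_le_sum (fun k _ => by positivity)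
        (Finset.mem_range.mpr (show 0 < r / 2 + 1 by omega)))
    simp

end TensorGrowth

theorem mainTheorem10 (m r : ℕ) (hm : 1 ≤ m) (hr : 1 ≤ r)
    {V : Type*} [AddCommGroup V] [Module ℂ V] [FiniteDimensional ℂ V]
    (ρ : Representation ℂ (TensorGrowth.GeneralizedSymmetricGroup m r) V)
    (hfaithful : Function.Injective ρ) (hsimple : ρ.IsIrreducible) :
    -- `b(n)` is well defined: `V^{⊗n}` is a direct sum of `k` indecomposables iff `k = b(n)`
    (∀ n k : ℕ,
      TensorGrowth.HasIndecomposableDecomposition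
        (MonoidAlgebra ℂ (TensorGrowth.GeneralizedSymmetricGroup m r))
        (TensorGrowth.TensorPowerModule ρ n) k ↔ k = TensorGrowth.numSummands ρ n) ∧
    -- `l(n) = b(n)`
    (∀ n : ℕ, TensorGrowth.numCompositionFactors ρ n = (TensorGrowth.numSummands ρ n : ℕ∞)) ∧
    -- `b(n) ∼ a(n)`
    Filter.Tendsto
      (fun n : ℕ => (TensorGrowth.numSummands ρ n : ℂ) / TensorGrowth.asymptoticFormula ρ n)
      Filter.atTop (nhds 1) ∧
    -- the value of `a(n)`
    (∀ n : ℕ, TensorGrowth.asymptoticFormula ρ n =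
      if Even r ∧ Even m then
        ((∑ k ∈ Finset.range (r / 2 + 1),
            1 / ((m : ℂ) ^ k * (r - 2 * k).factorial * k.factorial * 2 ^ k)) +
          1 / ((r / 2).factorial * (m : ℂ) ^ r) * ((m : ℂ) / 2) ^ (r / 2) * (-1) ^ n) *
          (Module.finrank ℂ V : ℂ) ^ n
      else
        (∑ k ∈ Finset.range (r / 2 + 1),
            1 / (((r - 2 * k).factorial : ℂ) * k.factorial * 2 ^ k * (m : ℂ) ^ k)) *
          (Module.finrank ℂ V : ℂ) ^ n) := by
  have : NeZero m := NeZero.of_pos hm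
  have hnt : Nontrivial V := hsimple.nontrivial
  have hdec := fun n => TensorGrowth.hasIndecomposableDecomposition_iff
    (TensorGrowth.tensorPower ρ n)
  refine ⟨hdec, fun n => ((hdec n _).mpr rfl).length_eq, ?_,
    TensorGrowth.asymptoticFormula_closed_form hm hr ρ hfaithful hsimple⟩
  exact TensorGrowth.tendsto_numSummands_div hfaithful
    (by positivity : (0 : ℝ) < 1 / (r.factorial : ℝ))
    (TensorGrowth.le_norm_asymptoticFormula hm hr ρ hfaithful hsimple)
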